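/- Consider the class of generalized Burgers equations $$u_t+uu_x+h(t)u=g(t)u_{xx},\qquad (*)$$ where $h$ and $g$ are smooth functions on an open interval $I$ (which may differ from equation to equation) and $g\neq0$ on $I$. For each equation fix an antiderivative $\theta(t)=\int e^{-\int h\,dt}\,dt$. A generalized extended equivalence transformation of the class is an invertible transformation that permutes the equations of the class and acts on the variables $(t,x,u)$, for each equation, by a point transformation mapping this equation to its image; the $(t,x,u)$-components may depend, even nonlocally, on $h$ and $g$. These transformations form a group, the generalized extended equivalence group of the class, and it consists of the transformations whose action on each equation and on $(t,x,u)$ over its interval has the form $$\tilde t=T(t),\qquad \tilde x=\bigl(x+\mu_1\theta+\mu_0\bigr)X^1,\qquad \tilde u=\frac{X^1}{T_t}\left(u+\bigl(x+\mu_1\theta+\mu_0\bigr)\frac{X^1_t}{X^1}+\mu_1\theta_t\right),$$ $$\tilde h=\frac1{T_t}\left(h+\frac{T_{tt}}{T_t}-2\frac{X^1_t}{X^1}\right),\qquad \tilde g=\frac{(X^1)^2}{T_t}\,g,\qquad X^1=\left(\gamma\int e^{-\int h\,dt}\,dt+\delta\right)^{-1}=(\gamma\theta+\delta)^{-1}.$$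 Here $T$ is an arbitrary smooth function with $T_t\neq0$, and $\mu_0,\mu_1,\gamma,\delta$ are arbitrary constants with $(\gamma,\delta)\neq(0,0)$ and $\gamma\theta+\delta\neq0$ on the interval under consideration; within one transformation, these parameters may vary with the equation. Every admissible choice of the parameters occurs for every equation. Moreover, the class is normalized in the generalized extended sense: every point transformation, even if it is only defined on a convex open set of points $(t,x,u)$, that maps an equation of the class to an equation of the class is induced by an element of this group. Explicitly, such point transformations, together with their source and target equations, are exactly those given by the above formulas. -/

import Mathlib

open scoped ContDiff Topology

/-- An equation `u_t + u u_x + h(t) u = g(t) u_xx` of the class. The arbitrary elements `h` and `g`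
are smooth functions on a nonempty open interval `I`, and `g` vanishes nowhere on `I`. The values
of `h` and `g` off `I` have no meaning; they are set to `0`, so that equal equations are equal
as terms. -/
@[ext] structure BurgersEq where
  I : Set ℝ
  h : ℝ → ℝ
  g : ℝ → ℝ
  isOpen_I : IsOpen I
  ordConnected_I : I.OrdConnected
  nonempty_I : I.Nonempty
  smooth_h : ContDiffOn ℝ ∞ h I
  smooth_g : ContDiffOn ℝ ∞ g I
  g_ne_zero : ∀ t ∈ I, g t ≠ 0
  h_off : ∀ t, t ∉ I → h t = 0
  g_off : ∀ t, t ∉ I → g t = 0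

namespace BurgersEq

/-- The part of the space of the variables `(t, x, u)` over the interval of the equation. -/
def strip (L : BurgersEq) : Set (ℝ × ℝ × ℝ) := {p | p.1 ∈ L.I}

/-- The function `u = f(t, x)` satisfies the equation at the point `(t, x)`; in other words, the
second-order jet of `f` at `(t, x)` lies on the manifold defined by the equation. -/
def HoldsAt (L : BurgersEq) (f : ℝ → ℝ → ℝ) (t x : ℝ) : Prop :=
  deriv (fun s => f s x) t + f t x * deriv (fun y => f t y) x + L.h t * f t x
    = L.g t * deriv (deriv fun y => f t y) x

/-- `L₁` is the equation `L` considered over a smaller interval. -/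
def IsRestriction (L₁ L : BurgersEq) : Prop :=
  L₁.I ⊆ L.I ∧ Set.EqOn L₁.h L.h L₁.I ∧ Set.EqOn L₁.g L.g L₁.I

/-- `θ` is an antiderivative `∫ e^{-∫ h dt} dt` on the interval of the equation, for some choice
of the inner antiderivative. -/
def IsDampingIntegral (L : BurgersEq) (θ : ℝ → ℝ) : Prop :=
  ∃ H : ℝ → ℝ, (∀ t ∈ L.I, HasDerivAt H (L.h t) t) ∧
    ∀ t ∈ L.I, HasDerivAt θ (Real.exp (-H t)) t

end BurgersEq

/-- `F` restricts to a point transformation `(t, x, u) ↦ (T, X, U)` on `Ω`: it is smooth, with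
nonvanishing Jacobian. -/
def IsPointTransformation (F : ℝ × ℝ × ℝ → ℝ × ℝ × ℝ) (Ω : Set (ℝ × ℝ × ℝ)) : Prop :=
  ContDiffOn ℝ ∞ F Ω ∧ ∀ p ∈ Ω, (fderiv ℝ F p).det ≠ 0

/-- The transformation of the independent variables that `F` induces along the graph of `f`. -/
def baseMap (F : ℝ × ℝ × ℝ → ℝ × ℝ × ℝ) (f : ℝ → ℝ → ℝ) (q : ℝ × ℝ) : ℝ × ℝ :=
  ((F (q.1, q.2, f q.1 q.2)).1, (F (q.1, q.2, f q.1 q.2)).2.1)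

/-- The function `f'` is the image of the function `f` under `F` near the point `q`: both are
smooth, the induced transformation of the independent variables is nondegenerate at `q`, and `F`
sends points of the graph of `f` over a neighbourhood of `q` to points of the graph of `f'`. -/
def IsImageNear (F : ℝ × ℝ × ℝ → ℝ × ℝ × ℝ) (f f' : ℝ → ℝ → ℝ) (q : ℝ × ℝ) : Prop :=
  ContDiffAt ℝ ∞ (fun r : ℝ × ℝ => f r.1 r.2) q ∧
  ContDiffAt ℝ ∞ (fun r : ℝ × ℝ => f' r.1 r.2) (baseMap F f q) ∧
  (fderiv ℝ (baseMap F f) q).det ≠ 0 ∧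
  ∀ᶠ r in 𝓝 q, f' (baseMap F f r).1 (baseMap F f r).2 = (F (r.1, r.2, f r.1 r.2)).2.2

/-- `F`, prolonged to second-order jets, maps the manifold of `L` over `Ω` into the manifold
of `L'`. Second-order jets are represented by arbitrary smooth functions (not only by solutions). -/
def MapsEquation (L L' : BurgersEq) (F : ℝ × ℝ × ℝ → ℝ × ℝ × ℝ) (Ω : Set (ℝ × ℝ × ℝ)) : Prop :=
  ∀ (f f' : ℝ → ℝ → ℝ) (t x : ℝ), (t, x, f t x) ∈ Ω → IsImageNear F f f' (t, x) →
    L.HoldsAt f t x →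
      L'.HoldsAt f' (baseMap F f (t, x)).1 (baseMap F f (t, x)).2

/-- `(L, L', F)` is an admissible transformation of the class, the point transformation `F` being
considered on `Ω`. -/
def IsAdmissible (L L' : BurgersEq) (F : ℝ × ℝ × ℝ → ℝ × ℝ × ℝ) (Ω : Set (ℝ × ℝ × ℝ)) : Prop :=
  Ω ⊆ L.strip ∧ Set.MapsTo F Ω L'.strip ∧ IsPointTransformation F Ω ∧ MapsEquation L L' F Ω

/-- The joint space of the equations of the class and of the variables `(t, x, u)`. -/
abbrev JointSpace := {z : BurgersEq × (ℝ × ℝ × ℝ) // z.2 ∈ z.1.strip}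

/-- A generalized extended equivalence transformation of the class: an invertible transformation
of the joint space that permutes the equations of the class and acts on the variables `(t, x, u)`,
for each equation `L`, by a point transformation that maps `L` to its image. The components for
`(t, x, u)` may depend on the arbitrary elements (generalized), in a nonlocal way (extended). -/
def IsGenExtEquivalence (σ : Equiv.Perm JointSpace) : Prop :=
  ∃ S : Equiv.Perm BurgersEq, ∀ L : BurgersEq, ∃ F : ℝ × ℝ × ℝ → ℝ × ℝ × ℝ,
    IsAdmissible L (S L) F L.strip ∧
    ∀ p (hp : p ∈ L.strip), (σ ⟨(L, p), hp⟩).1 = (S L, F p)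

/-- The class is normalized with respect to `G`: every admissible transformation `(L, L', F)`,
even if `F` is only defined on a convex open set `Ω`, is induced by an element of `G` (over the
interval of those `t` that occur in `Ω`). -/
def IsNormalizedWith (G : Subgroup (Equiv.Perm JointSpace)) : Prop :=
  ∀ (L L' : BurgersEq) (F : ℝ × ℝ × ℝ → ℝ × ℝ × ℝ) (Ω : Set (ℝ × ℝ × ℝ)),
    IsOpen Ω → Convex ℝ Ω → Ω.Nonempty → IsAdmissible L L' F Ω →
    ∃ σ ∈ G, ∃ L₁ L₁' : BurgersEq,
      L₁.IsRestriction L ∧ L₁.I = Prod.fst '' Ω ∧ L₁'.IsRestriction L' ∧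
      ∀ z : JointSpace, z.1.1 = L₁ → z.1.2 ∈ Ω → (σ z).1 = (L₁', F z.1.2)

/-- The parameters of the transformations: the function `T` and the constants. -/
structure TransfParams where
  T : ℝ → ℝ
  γ : ℝ
  δ : ℝ
  μ₀ : ℝ
  μ₁ : ℝ

namespace TransfParams

/-- `X¹ = (γ θ + δ)⁻¹`, where `θ = ∫ e^{-∫ h dt} dt`. -/
noncomputable def X1 (c : TransfParams) (θ : ℝ → ℝ) (t : ℝ) : ℝ := (c.γ * θ t + c.δ)⁻¹

/-- The conditions on the parameters, over the set `J` of values of `t`. -/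
def Valid (c : TransfParams) (θ : ℝ → ℝ) (J : Set ℝ) : Prop :=
  ContDiffOn ℝ ∞ c.T J ∧ (∀ t ∈ J, deriv c.T t ≠ 0) ∧ (c.γ, c.δ) ≠ (0, 0) ∧
    ∀ t ∈ J, c.γ * θ t + c.δ ≠ 0

/-- The components of the transformation for `(t, x, u)`. -/
noncomputable def map (c : TransfParams) (θ : ℝ → ℝ) (p : ℝ × ℝ × ℝ) : ℝ × ℝ × ℝ :=
  let t := p.1
  let x := p.2.1
  let u := p.2.2
  (c.T t,
   (x + c.μ₁ * θ t + c.μ₀) * c.X1 θ t,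
   c.X1 θ t / deriv c.T t *
     (u + (x + c.μ₁ * θ t + c.μ₀) * (deriv (c.X1 θ) t / c.X1 θ t) + c.μ₁ * deriv θ t))

/-- The transformation rules for the arbitrary elements, over the set `J` of values of `t`. -/
def ElementRules (c : TransfParams) (θ : ℝ → ℝ) (L L' : BurgersEq) (J : Set ℝ) : Prop :=
  ∀ t ∈ J,
    L'.h (c.T t) = 1 / deriv c.T t *
      (L.h t + deriv (deriv c.T) t / deriv c.T t - 2 * (deriv (c.X1 θ) t / c.X1 θ t)) ∧
    L'.g (c.T t) = c.X1 θ t ^ 2 / deriv c.T t * L.g t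

end TransfParams

/-!
An admissible transformation is determined from its action on second-order jets. If `f` satisfies
`L` at a point and `f'` is its image under `F = (T, X, U)`, then the derivatives of `f'` that enter
`L'` are found from `f' (T, X) = U` by the chain rule along a line in the `(t, x)`-plane
(`MapsEquation.jet_relations`; the inverse function theorem supplies `f'`). The jet of `f` at the
point is arbitrary apart from the equation `L`, and varying it splits the equation `L'`:

* `f_tt` does not occur in `L`, and its coefficient in `f'_xx` is a multiple of the square of the
  total derivative of `T` in `x`; hence `T = T(t)` (`AdmissibleOn.time_vertical`);
* the coefficient of `f_xx` gives `X_u = 0` and `g X_x ^ 2 = g' T_t`, so that `X_xx = 0`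
  (`AdmissibleOn.space_relation`, `AdmissibleOn.px_px_X`);
* the powers of `f_x` give `U_uu = 0` and then `T_t U = X_x u + X_t`
  (`AdmissibleOn.velocity_relations`, `AdmissibleOn.pt_T_mul_U`), and an affine relation in `(x, u)`.

On a convex domain this says that `T = T(t)`, `X = A(t) x + B(t)`, that `u` transforms as the
velocity `dx / dt`, and that `1 / A` and `B / A` solve the linear equation `y'' = -h y'`
(`IsNormalForm`, `IsAdmissible.exists_isNormalForm`). Since `θ'' = -h θ'`, the solutions of this
equation are the functions `γ θ + δ`, which are the constants of the theorem
(`IsNormalForm.exists_params`). Conversely, a direct computation shows that every normal form is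
admissible (`IsNormalForm.isAdmissible`).

Normal forms are closed under composition and inversion, which makes the fiberwise normal
transformations of the joint space a group (`normalFormGroup`). A normal form from an equation onto
its image is realized in this group by the transposition of the two equations
(`IsNormalForm.exists_mem_group`); applied to restrictions of the equations to smaller intervals,
this gives normalization.
-/

/-! ### Calculus -/

theorem ContDiffAt.eventually_hasDerivAt {E : Type*} [NormedAddCommGroup E] [NormedSpace ℝ E]
    {f : ℝ → E} {t : ℝ} (hf : ContDiffAt ℝ ∞ f t) : ∀ᶠ s in 𝓝 t, HasDerivAt f (deriv f s) s := by
  filter_upwards [(hf.of_le (m := 1) (by norm_cast)).eventually (by simp)] with s hs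
  exact (hs.differentiableAt (by simp)).hasDerivAt

theorem ContDiffAt.deriv_infty {E : Type*} [NormedAddCommGroup E] [NormedSpace ℝ E]
    {f : ℝ → E} {t : ℝ} (hf : ContDiffAt ℝ ∞ f t) : ContDiffAt ℝ ∞ (deriv f) t := by
  have h := (hf.fderiv_right (m := ∞) (by simp)).clm_apply (contDiffAt_const (c := (1 : ℝ)))
  exact h

/-- The second-order chain rule along a curve. -/
theorem deriv_deriv_comp_curve {E G : Type*} [NormedAddCommGroup E] [NormedSpace ℝ E]
    [NormedAddCommGroup G] [NormedSpace ℝ G] {Φ : E → G} {γ : ℝ → E} {s₀ : ℝ}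
    (hΦ : ContDiffAt ℝ ∞ Φ (γ s₀)) (hγ : ContDiffAt ℝ ∞ γ s₀) :
    deriv (deriv fun s => Φ (γ s)) s₀ =
      fderiv ℝ (fderiv ℝ Φ) (γ s₀) (deriv γ s₀) (deriv γ s₀)
        + fderiv ℝ Φ (γ s₀) (deriv (deriv γ) s₀) := by
  have h1 : (deriv fun s => Φ (γ s)) =ᶠ[𝓝 s₀] fun s => fderiv ℝ Φ (γ s) (deriv γ s) := by
    have hev := hγ.continuousAt.eventually
      ((hΦ.of_le (m := 1) (by norm_cast)).eventually (by simp))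
    filter_upwards [hev, hγ.eventually_hasDerivAt] with s hs hs'
    exact ((hs.differentiableAt (by simp)).hasFDerivAt.comp_hasDerivAt s hs').deriv
  rw [h1.deriv_eq]
  have hA : HasDerivAt (fun s => fderiv ℝ Φ (γ s))
      (fderiv ℝ (fderiv ℝ Φ) (γ s₀) (deriv γ s₀)) s₀ := by
    have hd : DifferentiableAt ℝ (fderiv ℝ Φ) (γ s₀) :=
      (hΦ.fderiv_right (m := ∞) (by simp)).differentiableAt (by simp)
    exact hd.hasFDerivAt.comp_hasDerivAt s₀ hγ.eventually_hasDerivAt.self_of_nhds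
  have hB := hγ.deriv_infty.eventually_hasDerivAt.self_of_nhds
  exact (hA.clm_apply hB).deriv

theorem det_ne_zero_of_ker {E : Type*} [NormedAddCommGroup E] [NormedSpace ℝ E]
    [FiniteDimensional ℝ E] (A : E →L[ℝ] E) (h : ∀ v, A v = 0 → v = 0) : A.det ≠ 0 := by
  intro h0
  have hlt := LinearMap.bot_lt_ker_of_det_eq_zero (f := (A : E →ₗ[ℝ] E)) h0
  refine hlt.ne' ((LinearMap.ker_eq_bot').2 fun v hv => h v hv)

theorem exists_preimage_of_det_ne_zero {E : Type*} [NormedAddCommGroup E] [NormedSpace ℝ E]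
    [FiniteDimensional ℝ E] (A : E →L[ℝ] E) (h : A.det ≠ 0) (w : E) : ∃ v, A v = w :=
  ⟨(A.toContinuousLinearEquivOfDetNeZero h).symm w, by
    rw [← A.toContinuousLinearEquivOfDetNeZero_apply h]; simp⟩

/-- A smooth function with nonsingular derivative has a smooth local inverse. -/
theorem exists_local_inverse {E : Type*} [NormedAddCommGroup E] [NormedSpace ℝ E]
    [FiniteDimensional ℝ E] {B : E → E} {q : E} (hB : ContDiffAt ℝ ∞ B q)
    (hd : (fderiv ℝ B q).det ≠ 0) :
    ∃ R : E → E, ContDiffAt ℝ ∞ R (B q) ∧ R (B q) = q ∧ ∀ᶠ r in 𝓝 q, R (B r) = r := by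
  have : CompleteSpace E := FiniteDimensional.complete ℝ E
  set e := (fderiv ℝ B q).toContinuousLinearEquivOfDetNeZero hd with he
  have hf' : HasFDerivAt B (e : E →L[ℝ] E) q := by
    rw [he, ContinuousLinearMap.coe_toContinuousLinearEquivOfDetNeZero]
    exact (hB.differentiableAt (by simp)).hasFDerivAt
  have hs := hB.hasStrictFDerivAt' hf' (by simp)
  exact ⟨hs.localInverse B e q, hB.to_localInverse hf' (by simp), hs.localInverse_apply_image,
    hs.eventually_left_inverse⟩

theorem deriv_deriv_clm_comp {E G : Type*} [NormedAddCommGroup E] [NormedSpace ℝ E]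
    [NormedAddCommGroup G] [NormedSpace ℝ G] (A : E →L[ℝ] G) {γ : ℝ → E} {s₀ : ℝ}
    (hγ : ContDiffAt ℝ ∞ γ s₀) :
    deriv (deriv fun s => A (γ s)) s₀ = A (deriv (deriv γ) s₀) := by
  rw [deriv_deriv_comp_curve A.contDiff.contDiffAt hγ]
  have : fderiv ℝ (A : E → G) = fun _ => A := by ext1 z; exact A.fderiv
  simp [this]

theorem clm_apply_pair (l : ℝ × ℝ →L[ℝ] ℝ) (α β : ℝ) :
    l (α, β) = α * l (1, 0) + β * l (0, 1) := by
  rw [← smul_eq_mul, ← smul_eq_mul, ← map_smul, ← map_smul, ← map_add]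
  simp

/-! ### The prolongation of a point transformation to second-order jets -/

/-- The prolongation to second-order jets, for the function
`f(s, y) = u + a (s - t) + p (y - x) + r (y - x) ^ 2 / 2 + c (s - t) ^ 2 / 2`. The numbers `φ₁`,
`φ₂`, `φ₂₂` are the derivatives `f'_t`, `f'_x`, `f'_xx` of its image. The first two relations are
the chain rule for first derivatives; the third is the second-order chain rule along the line with
the direction `(w₁, w₂)` that is mapped to the direction of `x`; the last is the equation `L'`.
The value `c` of `f_tt` is free, since `L` does not involve it. -/
theorem MapsEquation.jet_relations {L L' : BurgersEq} {F : ℝ × ℝ × ℝ → ℝ × ℝ × ℝ}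
    {Ω : Set (ℝ × ℝ × ℝ)} (hΩ : IsOpen Ω) (hF : ContDiffOn ℝ ∞ F Ω)
    (hmap : MapsEquation L L' F Ω) {t x u : ℝ} (hp : (t, x, u) ∈ Ω) {a p r : ℝ} (c : ℝ)
    (hrel : a + u * p + L.h t * u = L.g t * r)
    (hnd : (fderiv ℝ F (t, x, u) (1, 0, a)).1 * (fderiv ℝ F (t, x, u) (0, 1, p)).2.1
      - (fderiv ℝ F (t, x, u) (0, 1, p)).1 * (fderiv ℝ F (t, x, u) (1, 0, a)).2.1 ≠ 0) :
    ∃ φ₁ φ₂ φ₂₂ : ℝ,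
      (fderiv ℝ F (t, x, u) (1, 0, a)).2.2 = φ₁ * (fderiv ℝ F (t, x, u) (1, 0, a)).1
        + φ₂ * (fderiv ℝ F (t, x, u) (1, 0, a)).2.1 ∧
      (fderiv ℝ F (t, x, u) (0, 1, p)).2.2 = φ₁ * (fderiv ℝ F (t, x, u) (0, 1, p)).1
        + φ₂ * (fderiv ℝ F (t, x, u) (0, 1, p)).2.1 ∧
      (∀ w₁ w₂ : ℝ,
        w₁ * (fderiv ℝ F (t, x, u) (1, 0, a)).1 + w₂ * (fderiv ℝ F (t, x, u) (0, 1, p)).1 = 0 →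
        w₁ * (fderiv ℝ F (t, x, u) (1, 0, a)).2.1
          + w₂ * (fderiv ℝ F (t, x, u) (0, 1, p)).2.1 = 1 →
        ∀ Q : ℝ × ℝ × ℝ,
          Q = fderiv ℝ (fderiv ℝ F) (t, x, u) (w₁, w₂, a * w₁ + p * w₂) (w₁, w₂, a * w₁ + p * w₂)
            + fderiv ℝ F (t, x, u) (0, 0, r * w₂ ^ 2 + c * w₁ ^ 2) →
          Q.2.2 = φ₂₂ + φ₁ * Q.1 + φ₂ * Q.2.1) ∧
      φ₁ + (F (t, x, u)).2.2 * φ₂ + L'.h (F (t, x, u)).1 * (F (t, x, u)).2.2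
        = L'.g (F (t, x, u)).1 * φ₂₂ := by
  obtain ⟨f, hfdef⟩ : ∃ f : ℝ → ℝ → ℝ, f = fun s y =>
    u + a * (s - t) + p * (y - x) + r / 2 * (y - x) ^ 2 + c / 2 * (s - t) ^ 2 := ⟨_, rfl⟩
  have hf0 : f t x = u := by simp [hfdef]
  obtain ⟨γ₀, hγ₀def⟩ : ∃ γ₀ : ℝ × ℝ → ℝ × ℝ × ℝ, γ₀ = fun z => (z.1, z.2, f z.1 z.2) := ⟨_, rfl⟩
  have hfs : ContDiff ℝ ∞ fun z : ℝ × ℝ => f z.1 z.2 := by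
    rw [hfdef]; fun_prop
  have hγ₀ : ContDiff ℝ ∞ γ₀ := by
    rw [hγ₀def]; exact contDiff_fst.prodMk (contDiff_snd.prodMk hfs)
  have hγ₀q : γ₀ (t, x) = (t, x, u) := by simp [hγ₀def, hf0]
  have hFp : ContDiffAt ℝ ∞ F (γ₀ (t, x)) := by rw [hγ₀q]; exact hF.contDiffAt (hΩ.mem_nhds hp)
  -- restriction of the jet extension to a line
  have hline : ∀ (w₁ w₂ s : ℝ), γ₀ ((t, x) + s • (w₁, w₂)) =
      (t + s * w₁, x + s * w₂, u + (a * w₁ + p * w₂) * s + (r * w₂ ^ 2 + c * w₁ ^ 2) / 2 * s ^ 2) := by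
    intro w₁ w₂ s
    simp only [hγ₀def, hfdef, Prod.smul_mk, Prod.mk_add_mk, smul_eq_mul, Prod.mk.injEq, true_and]
    ring
  have hl : ∀ (w : ℝ × ℝ) (s : ℝ), HasDerivAt (fun s : ℝ => (t, x) + s • w) w s := by
    intro w s
    simpa using ((hasDerivAt_id s).smul_const w).const_add (t, x)
  have hls : ∀ w : ℝ × ℝ, ContDiff ℝ ∞ (fun s : ℝ => (t, x) + s • w) := by
    intro w; fun_prop
  have hder : ∀ (w₁ w₂ s : ℝ), HasDerivAt (fun s : ℝ => γ₀ ((t, x) + s • (w₁, w₂)))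
      (w₁, w₂, a * w₁ + p * w₂ + (r * w₂ ^ 2 + c * w₁ ^ 2) * s) s := by
    intro w₁ w₂ s
    simp only [hline]
    refine HasDerivAt.prodMk ?_ (HasDerivAt.prodMk ?_ ?_)
    · simpa using ((hasDerivAt_id s).mul_const w₁).const_add t
    · simpa using ((hasDerivAt_id s).mul_const w₂).const_add x
    · have := (((hasDerivAt_id s).const_mul (a * w₁ + p * w₂)).const_add u).add
        (((hasDerivAt_id s).pow 2).const_mul ((r * w₂ ^ 2 + c * w₁ ^ 2) / 2))
      refine this.congr_deriv ?_
      simp; ring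
  have hγ₀d : ∀ w₁ w₂ : ℝ, fderiv ℝ γ₀ (t, x) (w₁, w₂) = (w₁, w₂, a * w₁ + p * w₂) := by
    intro w₁ w₂
    have h1 := (hγ₀.differentiable (by simp)
      ((t, x) + (0 : ℝ) • (w₁, w₂))).hasFDerivAt.comp_hasDerivAt (0 : ℝ) (hl (w₁, w₂) 0)
    have h2 := h1.unique (hder w₁ w₂ 0)
    simpa using h2
  -- the induced transformation of the independent variables
  obtain ⟨W, hWdef⟩ : ∃ W : ℝ × ℝ → ℝ × ℝ × ℝ, W = fun z => F (γ₀ z) := ⟨_, rfl⟩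
  have hW : ContDiffAt ℝ ∞ W (t, x) := by rw [hWdef]; exact hFp.comp (t, x) hγ₀.contDiffAt
  have hWd : ∀ w₁ w₂ : ℝ, fderiv ℝ W (t, x) (w₁, w₂) =
      w₁ • fderiv ℝ F (t, x, u) (1, 0, a) + w₂ • fderiv ℝ F (t, x, u) (0, 1, p) := by
    intro w₁ w₂
    have h1 : fderiv ℝ W (t, x) = (fderiv ℝ F (γ₀ (t, x))).comp (fderiv ℝ γ₀ (t, x)) := by
      rw [hWdef]
      exact ((hFp.differentiableAt (by simp)).hasFDerivAt.comp (t, x)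
        (hγ₀.differentiable (by simp) (t, x)).hasFDerivAt).fderiv
    rw [h1, ContinuousLinearMap.comp_apply, hγ₀d, hγ₀q, ← map_smul, ← map_smul, ← map_add]
    congr 1
    simp [mul_comm]
  have hB : baseMap F f = fun z => ((W z).1, (W z).2.1) := by
    rw [hWdef, hγ₀def]; rfl
  have hBs : ContDiffAt ℝ ∞ (baseMap F f) (t, x) := by
    rw [hB]; exact (contDiffAt_fst.comp (t, x) hW).prodMk
      (contDiffAt_fst.comp (t, x) (contDiffAt_snd.comp (t, x) hW))
  have hBd : ∀ w, fderiv ℝ (baseMap F f) (t, x) w =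
      ((fderiv ℝ W (t, x) w).1, (fderiv ℝ W (t, x) w).2.1) := by
    intro w
    have hd := (hW.differentiableAt (by simp)).hasFDerivAt
    rw [hB]
    have := (hd.fst.prodMk hd.snd.fst).fderiv
    rw [this]; rfl
  -- the kernel is trivial by Cramer's rule
  have hdet : (fderiv ℝ (baseMap F f) (t, x)).det ≠ 0 := by
    refine det_ne_zero_of_ker _ fun w hw => ?_
    obtain ⟨w₁, w₂⟩ := w
    rw [hBd, hWd, Prod.mk_eq_zero] at hw
    simp only [Prod.fst_add, Prod.smul_fst, smul_eq_mul, Prod.snd_add, Prod.smul_snd] at hw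
    obtain ⟨e1, e2⟩ := hw
    rw [Prod.mk_eq_zero]
    constructor
    · refine (mul_eq_zero.1 ?_).resolve_right hnd
      linear_combination (fderiv ℝ F (t, x, u) (0, 1, p)).2.1 * e1
        - (fderiv ℝ F (t, x, u) (0, 1, p)).1 * e2
    · refine (mul_eq_zero.1 ?_).resolve_right hnd
      linear_combination (fderiv ℝ F (t, x, u) (1, 0, a)).1 * e2
        - (fderiv ℝ F (t, x, u) (1, 0, a)).2.1 * e1
  -- the image of `f` is obtained by means of a local inverse of the base transformation
  obtain ⟨R, hR, hRq, hRB⟩ := exists_local_inverse hBs hdet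
  obtain ⟨φ, hφdef⟩ : ∃ φ : ℝ × ℝ → ℝ, φ = fun z => (W (R z)).2.2 := ⟨_, rfl⟩
  have hφ : ContDiffAt ℝ ∞ φ (baseMap F f (t, x)) := by
    rw [hφdef]
    have : ContDiffAt ℝ ∞ W (R (baseMap F f (t, x))) := by rw [hRq]; exact hW
    exact contDiffAt_snd.comp _ (contDiffAt_snd.comp _ (this.comp _ hR))
  have hφB : ∀ᶠ z in 𝓝 (t, x), φ (baseMap F f z) = (W z).2.2 := by
    filter_upwards [hRB] with z hz
    simp [hφdef, hz]
  have himg : IsImageNear F f (fun s y => φ (s, y)) (t, x) := by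
    refine ⟨hfs.contDiffAt, hφ, hdet, ?_⟩
    filter_upwards [hφB] with z hz
    simpa [hWdef, hγ₀def] using hz
  have hxf : deriv (fun y => f t y) = fun y => p + r * (y - x) := by
    ext y
    have h1 := (((hasDerivAt_id y).sub_const x).const_mul p).const_add (u + a * (t - t))
    have h2 := (((hasDerivAt_id y).sub_const x).pow 2).const_mul (r / 2)
    have h3 := ((h1.add h2).add_const (c / 2 * (t - t) ^ 2)).deriv
    simp only [hfdef]
    refine h3.trans ?_
    simp; ring
  have hsrc : L.HoldsAt f t x := by
    have htf : deriv (fun s => f s x) t = a := by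
      have h1 := hder 1 0 0
      have h1' := h1.differentiableAt.hasFDerivAt.snd.snd.hasDerivAt
      have := h1'.deriv
      rw [ContinuousLinearMap.comp_apply, ContinuousLinearMap.comp_apply] at this
      rw [show fderiv ℝ (fun s : ℝ => γ₀ ((t, x) + s • ((1 : ℝ), (0 : ℝ)))) 0 1 = _ from
        h1.deriv] at this
      have h2 : (fun s : ℝ => (γ₀ ((t, x) + s • ((1 : ℝ), (0 : ℝ)))).2.2) = fun s => f (s + t) x := by
        ext s; simp [hγ₀def, add_comm]
      rw [h2, deriv_comp_add_const (f := fun s => f s x)] at this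
      simpa using this
    have hxxf : deriv (fun y => p + r * (y - x)) x = r := by simp
    unfold BurgersEq.HoldsAt
    rw [htf, hxf, hxxf, hf0]
    simp only [sub_self, mul_zero, add_zero]
    exact hrel
  have htgt := hmap f (fun s y => φ (s, y)) t x (by rw [hf0]; exact hp) himg hsrc
  unfold BurgersEq.HoldsAt at htgt
  obtain ⟨z, hz⟩ : ∃ z, z = baseMap F f (t, x) := ⟨_, rfl⟩
  have hz1 : z.1 = (F (t, x, u)).1 := by rw [hz, hB, hWdef]; simp [hγ₀q]
  have hzφ : φ z = (F (t, x, u)).2.2 := by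
    rw [hz, hφB.self_of_nhds, hWdef]; simp [hγ₀q]
  rw [← hz] at htgt hφ
  have hφd := (hφ.differentiableAt (by simp)).hasFDerivAt
  have ht1 : deriv (fun s => φ (s, z.2)) z.1 = fderiv ℝ φ z (1, 0) :=
    (HasFDerivAt.comp_hasDerivAt (f := fun s : ℝ => (s, z.2)) z.1 hφd
      ((hasDerivAt_id _).prodMk (hasDerivAt_const _ _))).deriv
  have ht2 : deriv (fun y => φ (z.1, y)) z.2 = fderiv ℝ φ z (0, 1) :=
    (HasFDerivAt.comp_hasDerivAt (f := fun s : ℝ => (z.1, s)) z.2 hφd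
      ((hasDerivAt_const _ _).prodMk (hasDerivAt_id _))).deriv
  have ht22 : deriv (deriv fun y => φ (z.1, y)) z.2 = fderiv ℝ (fderiv ℝ φ) z (0, 1) (0, 1) := by
    have h1 : deriv (fun s : ℝ => (z.1, s)) = fun _ => ((0 : ℝ), (1 : ℝ)) := by
      ext1 s; exact ((hasDerivAt_const _ _).prodMk (hasDerivAt_id _)).deriv
    have := deriv_deriv_comp_curve (Φ := φ) (γ := fun s : ℝ => (z.1, s)) (s₀ := z.2) hφ
      (by fun_prop)
    rw [this, h1]
    simp
  have hlin := clm_apply_pair (fderiv ℝ φ z)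
  have hchain : ∀ w, (fderiv ℝ W (t, x) w).2.2 = fderiv ℝ φ z (fderiv ℝ (baseMap F f) (t, x) w) := by
    intro w
    have h1 := (hW.differentiableAt (by simp)).hasFDerivAt.snd.snd
    have h2 : HasFDerivAt (fun z => φ (baseMap F f z))
        ((fderiv ℝ φ z).comp (fderiv ℝ (baseMap F f) (t, x))) (t, x) := by
      rw [hz] at hφd ⊢
      exact hφd.comp (t, x) (hBs.differentiableAt (by simp)).hasFDerivAt
    have h3 := (h2.congr_of_eventuallyEq (hφB.mono fun _ h => h.symm)).unique h1
    rw [← ContinuousLinearMap.comp_apply, h3]; rfl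
  refine ⟨fderiv ℝ φ z (1, 0), fderiv ℝ φ z (0, 1), fderiv ℝ (fderiv ℝ φ) z (0, 1) (0, 1),
    ?_, ?_, ?_, ?_⟩
  · have := hchain (1, 0)
    rw [hBd, hWd, hlin] at this
    simp only [one_smul, zero_smul, add_zero] at this
    rw [this]; ring
  · have := hchain (0, 1)
    rw [hBd, hWd, hlin] at this
    simp only [one_smul, zero_smul, zero_add] at this
    rw [this]; ring
  · intro w₁ w₂ hw1 hw2 Q hQ
    obtain ⟨ζ, hζdef⟩ : ∃ ζ : ℝ → ℝ × ℝ × ℝ, ζ = fun s => W ((t, x) + s • (w₁, w₂)) := ⟨_, rfl⟩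
    have hζ : ContDiffAt ℝ ∞ ζ 0 := by
      rw [hζdef]
      have : ContDiffAt ℝ ∞ W ((t, x) + (0 : ℝ) • (w₁, w₂)) := by simpa using hW
      exact this.comp 0 (hls _).contDiffAt
    have hζQ : deriv (deriv ζ) 0 = Q := by
      have h1 : deriv (fun s : ℝ => γ₀ ((t, x) + s • (w₁, w₂))) =
          fun s => (w₁, w₂, a * w₁ + p * w₂ + (r * w₂ ^ 2 + c * w₁ ^ 2) * s) := by
        ext1 s; exact (hder w₁ w₂ s).deriv
      have h2 : deriv (fun s : ℝ => (w₁, w₂, a * w₁ + p * w₂ + (r * w₂ ^ 2 + c * w₁ ^ 2) * s)) 0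
          = (0, 0, r * w₂ ^ 2 + c * w₁ ^ 2) := by
        refine ((hasDerivAt_const _ _).prodMk ((hasDerivAt_const _ _).prodMk ?_)).deriv
        simpa using ((hasDerivAt_id (0 : ℝ)).const_mul (r * w₂ ^ 2 + c * w₁ ^ 2)).const_add
          (a * w₁ + p * w₂)
      have h3 := deriv_deriv_comp_curve (Φ := F) (γ := fun s : ℝ => γ₀ ((t, x) + s • (w₁, w₂)))
        (s₀ := 0) (by simpa using hFp) (hγ₀.comp (hls _)).contDiffAt
      rw [h1, h2] at h3
      rw [hζdef, hWdef, h3, hQ]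
      simp [hγ₀q]
    have hζd : deriv ζ 0 = w₁ • fderiv ℝ F (t, x, u) (1, 0, a)
        + w₂ • fderiv ℝ F (t, x, u) (0, 1, p) := by
      rw [← hWd, hζdef]
      have : HasFDerivAt W (fderiv ℝ W (t, x)) ((t, x) + (0 : ℝ) • (w₁, w₂)) := by
        simpa using (hW.differentiableAt (by simp)).hasFDerivAt
      exact (this.comp_hasDerivAt (0 : ℝ) (hl (w₁, w₂) 0)).deriv
    let A : (ℝ × ℝ × ℝ) →L[ℝ] (ℝ × ℝ) := (ContinuousLinearMap.fst ℝ ℝ (ℝ × ℝ)).prod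
      ((ContinuousLinearMap.fst ℝ ℝ ℝ).comp (ContinuousLinearMap.snd ℝ ℝ (ℝ × ℝ)))
    let C : (ℝ × ℝ × ℝ) →L[ℝ] ℝ :=
      (ContinuousLinearMap.snd ℝ ℝ ℝ).comp (ContinuousLinearMap.snd ℝ ℝ (ℝ × ℝ))
    have hAζ0 : A (ζ 0) = z := by
      rw [hz, hB, hζdef]; simp [A]
    have hAζ : ContDiffAt ℝ ∞ (fun s => A (ζ s)) 0 := A.contDiff.contDiffAt.comp 0 hζ
    have hAd : deriv (fun s => A (ζ s)) 0 = (0, 1) := by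
      refine (A.hasFDerivAt.comp_hasDerivAt (0 : ℝ)
        (hζ.differentiableAt (by simp)).hasDerivAt).deriv.trans ?_
      rw [hζd]
      simp [A, hw1, hw2]
    have hev : (fun s => φ (A (ζ s))) =ᶠ[𝓝 0] fun s => C (ζ s) := by
      have hcont : Filter.Tendsto (fun s : ℝ => (t, x) + s • (w₁, w₂)) (𝓝 0) (𝓝 (t, x)) := by
        have := (hls (w₁, w₂)).continuous.tendsto 0
        simpa using this
      filter_upwards [hcont.eventually hφB] with s hs
      rw [hB] at hs
      rw [hζdef]
      exact hs
    have h1 := deriv_deriv_comp_curve (Φ := φ) (γ := fun s => A (ζ s)) (s₀ := 0)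
      (by rw [hAζ0]; exact hφ) hAζ
    rw [hev.deriv.deriv_eq, deriv_deriv_clm_comp C hζ, deriv_deriv_clm_comp A hζ, hAd, hAζ0,
      hζQ] at h1
    have h2 : A Q = (Q.1, Q.2.1) := rfl
    rw [h2, hlin] at h1
    have h3 : C Q = Q.2.2 := rfl
    rw [h3] at h1
    rw [h1]; ring
  · simp only [] at htgt
    rw [ht1, ht2, ht22, hz1] at htgt
    have h5 : φ ((F (t, x, u)).1, z.2) = (F (t, x, u)).2.2 := by rw [← hz1]; exact hzφ
    rw [h5] at htgt
    exact htgt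

/-! ### Partial derivatives on open sets of points `(t, x, u)` -/

/-- The directional derivative of `Φ` in the direction `v`, as a function of the point. -/
noncomputable def pd (v : ℝ × ℝ × ℝ) (Φ : ℝ × ℝ × ℝ → ℝ) : ℝ × ℝ × ℝ → ℝ :=
  fun p => fderiv ℝ Φ p v

/-- The partial derivative with respect to `t`. -/
local notation "∂ₜ" => pd (1, 0, 0)

/-- The partial derivative with respect to `x`. -/
local notation "∂ₓ" => pd (0, 1, 0)

/-- The partial derivative with respect to `u`. -/
local notation "∂ᵤ" => pd (0, 0, 1)

section PartialDerivatives

variable {Ω : Set (ℝ × ℝ × ℝ)} {Φ Ψ : ℝ × ℝ × ℝ → ℝ} {p : ℝ × ℝ × ℝ}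

theorem ContDiffOn.differentiableAt_infty (hΦ : ContDiffOn ℝ ∞ Φ Ω) (hΩ : IsOpen Ω) (hp : p ∈ Ω) :
    DifferentiableAt ℝ Φ p :=
  (hΦ.contDiffAt (hΩ.mem_nhds hp)).differentiableAt (by simp)

theorem contDiffOn_pd (hΦ : ContDiffOn ℝ ∞ Φ Ω) (hΩ : IsOpen Ω) (v : ℝ × ℝ × ℝ) :
    ContDiffOn ℝ ∞ (pd v Φ) Ω :=
  (hΦ.fderiv_of_isOpen hΩ (by simp)).clm_apply contDiffOn_const

theorem pd_congr (hΩ : IsOpen Ω) (h : Set.EqOn Φ Ψ Ω) (hp : p ∈ Ω) (v : ℝ × ℝ × ℝ) :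
    pd v Φ p = pd v Ψ p := by
  unfold pd
  rw [(h.eventuallyEq_of_mem (hΩ.mem_nhds hp)).fderiv_eq]

theorem pd_zero_of_eqOn (hΩ : IsOpen Ω) (h : ∀ p ∈ Ω, Φ p = 0) (hp : p ∈ Ω) (v : ℝ × ℝ × ℝ) :
    pd v Φ p = 0 := by
  rw [pd_congr hΩ (Ψ := fun _ => 0) h hp]
  simp [pd]

theorem pd_comm (hΦ : ContDiffOn ℝ ∞ Φ Ω) (hΩ : IsOpen Ω) (hp : p ∈ Ω) (v w : ℝ × ℝ × ℝ) :
    pd v (pd w Φ) p = pd w (pd v Φ) p := by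
  have hc := hΦ.contDiffAt (hΩ.mem_nhds hp)
  have hd : DifferentiableAt ℝ (fderiv ℝ Φ) p :=
    (hc.fderiv_right (m := ∞) (by simp)).differentiableAt (by simp)
  have key : ∀ v w, pd v (pd w Φ) p = fderiv ℝ (fderiv ℝ Φ) p v w := by
    intro v w
    have := (hd.hasFDerivAt.clm_apply (hasFDerivAt_const w p)).fderiv
    unfold pd
    rw [this]; simp
  rw [key, key]
  exact (hc.isSymmSndFDerivAt (by
    rw [minSmoothness_of_isRCLikeNormedField]
    exact WithTop.coe_le_coe.2 le_top)).eq v w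

theorem pd_mul (hΦ : DifferentiableAt ℝ Φ p) (hΨ : DifferentiableAt ℝ Ψ p) (v : ℝ × ℝ × ℝ) :
    pd v (fun z => Φ z * Ψ z) p = pd v Φ p * Ψ p + Φ p * pd v Ψ p := by
  unfold pd
  rw [fderiv_fun_mul hΦ hΨ]
  simp; ring

theorem pd_add (hΦ : DifferentiableAt ℝ Φ p) (hΨ : DifferentiableAt ℝ Ψ p) (v : ℝ × ℝ × ℝ) :
    pd v (fun z => Φ z + Ψ z) p = pd v Φ p + pd v Ψ p := by
  unfold pd
  rw [fderiv_fun_add hΦ hΨ]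
  simp

theorem pd_const_mul (hΦ : DifferentiableAt ℝ Φ p) (c : ℝ) (v : ℝ × ℝ × ℝ) :
    pd v (fun z => c * Φ z) p = c * pd v Φ p := by
  rw [pd_mul (differentiableAt_const c) hΦ]
  simp [pd]

theorem pd_eq_sum (Φ : ℝ × ℝ × ℝ → ℝ) (α β γ : ℝ) :
    pd (α, β, γ) Φ = fun p => α * ∂ₜ Φ p + (β * ∂ₓ Φ p + γ * ∂ᵤ Φ p) := by
  ext p
  simp only [pd, ← smul_eq_mul, ← map_smul, ← map_add]
  simp

theorem pd_comp_fst {φ : ℝ → ℝ} (hφ : DifferentiableAt ℝ φ p.1) (v : ℝ × ℝ × ℝ) :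
    pd v (fun z => φ z.1) p = v.1 * deriv φ p.1 := by
  have := (hφ.hasDerivAt.comp_hasFDerivAt p (hasFDerivAt_fst (𝕜 := ℝ) (p := p))).fderiv
  unfold pd
  rw [show (fun z : ℝ × ℝ × ℝ => φ z.1) = φ ∘ Prod.fst from rfl, this]
  simp [mul_comm]

theorem pd_comp {φ : ℝ → ℝ} (hφ : DifferentiableAt ℝ φ (Φ p)) (hΦ : DifferentiableAt ℝ Φ p)
    (v : ℝ × ℝ × ℝ) : pd v (fun z => φ (Φ z)) p = pd v Φ p * deriv φ (Φ p) := by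
  have := (hφ.hasDerivAt.comp_hasFDerivAt p hΦ.hasFDerivAt).fderiv
  unfold pd
  rw [show (fun z : ℝ × ℝ × ℝ => φ (Φ z)) = φ ∘ Φ from rfl, this]
  simp [mul_comm]

theorem pd_x (v : ℝ × ℝ × ℝ) : pd v (fun z => z.2.1) p = v.2.1 := by
  unfold pd
  rw [(hasFDerivAt_snd (𝕜 := ℝ) (p := p)).fst.fderiv]
  rfl

theorem pd_u (v : ℝ × ℝ × ℝ) : pd v (fun z => z.2.2) p = v.2.2 := by
  unfold pd
  rw [(hasFDerivAt_snd (𝕜 := ℝ) (p := p)).snd.fderiv]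
  rfl

/-- The second derivative along a line in a plane `t = const`. -/
theorem pd_pd_vertical (hΦ : ContDiffOn ℝ ∞ Φ Ω) (hΩ : IsOpen Ω) (hp : p ∈ Ω) (β γ : ℝ) :
    pd (0, β, γ) (pd (0, β, γ) Φ) p
      = β ^ 2 * ∂ₓ (∂ₓ Φ) p + 2 * β * γ * ∂ₓ (∂ᵤ Φ) p + γ ^ 2 * ∂ᵤ (∂ᵤ Φ) p := by
  have hx := (contDiffOn_pd hΦ hΩ (0, 1, 0)).differentiableAt_infty hΩ hp
  have hu := (contDiffOn_pd hΦ hΩ (0, 0, 1)).differentiableAt_infty hΩ hp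
  have h0 : pd (0, β, γ) Φ = fun z => β * ∂ₓ Φ z + γ * ∂ᵤ Φ z := by
    rw [pd_eq_sum]; simp
  rw [h0, pd_add (hx.const_mul β) (hu.const_mul γ), pd_const_mul hx, pd_const_mul hu]
  simp only [pd_eq_sum _ 0 β γ]
  have := pd_comm hΦ hΩ hp (0, 0, 1) (0, 1, 0)
  rw [this]
  ring

/-- On a convex open set, a function with vanishing derivatives in `x` and `u` is a function
of `t`. -/
theorem exists_function_of_t (hΩ : IsOpen Ω) (hc : Convex ℝ Ω) (hΦ : ContDiffOn ℝ ∞ Φ Ω)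
    (hx : ∀ p ∈ Ω, ∂ₓ Φ p = 0) (hu : ∀ p ∈ Ω, ∂ᵤ Φ p = 0) :
    ∃ φ : ℝ → ℝ, ContDiffOn ℝ ∞ φ (Prod.fst '' Ω) ∧ ∀ p ∈ Ω, φ p.1 = Φ p := by
  have hconst : ∀ p ∈ Ω, ∀ q ∈ Ω, p.1 = q.1 → Φ p = Φ q := by
    intro p hp q hq h
    have hcont : Continuous fun s : ℝ => AffineMap.lineMap (k := ℝ) p q s :=
      AffineMap.lineMap_continuous
    have hd : ∀ s : ℝ, AffineMap.lineMap p q s ∈ Ω →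
        HasDerivAt (fun s : ℝ => Φ (AffineMap.lineMap p q s)) 0 s := by
      intro s hs
      have h1 := (hΦ.differentiableAt_infty hΩ hs).hasFDerivAt.comp_hasDerivAt s
        (AffineMap.hasDerivAt_lineMap (𝕜 := ℝ) (a := p) (b := q) (x := s))
      refine h1.congr_deriv ?_
      have h2 : q - p = (0, q.2.1 - p.2.1, q.2.2 - p.2.2) := by
        ext <;> simp [h]
      rw [h2]
      change pd _ Φ _ = 0
      rw [pd_eq_sum]
      simp [hx _ hs, hu _ hs]
    have hpre := (hc.affine_preimage (AffineMap.lineMap (k := ℝ) p q)).isPreconnected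
    have := (hΩ.preimage hcont).is_const_of_deriv_eq_zero hpre
      (f := fun s : ℝ => Φ (AffineMap.lineMap p q s))
      (fun s hs => (hd s hs).differentiableAt.differentiableWithinAt)
      (fun s hs => (hd s hs).deriv) (x := 0) (y := 1) (by simpa using hp) (by simpa using hq)
    simpa using this
  classical
  obtain ⟨φ, hφ⟩ : ∃ φ : ℝ → ℝ, ∀ p ∈ Ω, φ p.1 = Φ p := by
    refine ⟨fun t => if h : ∃ p ∈ Ω, p.1 = t then Φ h.choose else 0, fun p hp => ?_⟩
    have h : ∃ q ∈ Ω, q.1 = p.1 := ⟨p, hp, rfl⟩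
    simp only [dif_pos h]
    exact hconst _ h.choose_spec.1 _ hp h.choose_spec.2
  refine ⟨φ, ?_, hφ⟩
  rintro t ⟨p, hp, rfl⟩
  have hcurve : ContDiff ℝ ∞ fun s : ℝ => (s, p.2) := by fun_prop
  have h1 : ContDiffAt ℝ ∞ (fun s : ℝ => Φ (s, p.2)) p.1 :=
    ContDiffAt.comp p.1 (f := fun s : ℝ => (s, p.2)) (g := Φ)
      (hΦ.contDiffAt (hΩ.mem_nhds hp)) hcurve.contDiffAt
  refine (h1.congr_of_eventuallyEq ?_).contDiffWithinAt
  have h2 : ∀ᶠ s in 𝓝 p.1, (s, p.2) ∈ Ω :=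
    hcurve.continuous.continuousAt.eventually (hΩ.mem_nhds hp)
  filter_upwards [h2] with s hs
  exact hφ _ hs

end PartialDerivatives

section Components

variable {Ω : Set (ℝ × ℝ × ℝ)} {F : ℝ × ℝ × ℝ → ℝ × ℝ × ℝ} {p : ℝ × ℝ × ℝ}

theorem fderiv_apply_components (hF : DifferentiableAt ℝ F p) (v : ℝ × ℝ × ℝ) :
    fderiv ℝ F p v =
      (pd v (fun z => (F z).1) p, pd v (fun z => (F z).2.1) p, pd v (fun z => (F z).2.2) p) := by
  have h := hF.hasFDerivAt
  unfold pd
  rw [h.fst.fderiv, h.snd.fst.fderiv, h.snd.snd.fderiv]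
  rfl

theorem fderiv_fderiv_apply_components (hF : ContDiffOn ℝ ∞ F Ω) (hΩ : IsOpen Ω) (hp : p ∈ Ω)
    (v w : ℝ × ℝ × ℝ) :
    fderiv ℝ (fderiv ℝ F) p v w = (pd v (pd w fun z => (F z).1) p,
      pd v (pd w fun z => (F z).2.1) p, pd v (pd w fun z => (F z).2.2) p) := by
  have hd : DifferentiableAt ℝ (fderiv ℝ F) p :=
    ((hF.contDiffAt (hΩ.mem_nhds hp)).fderiv_right (m := ∞) (by simp)).differentiableAt (by simp)
  have hD : DifferentiableAt ℝ (fun z => fderiv ℝ F z w) p := hd.clm_apply (differentiableAt_const w)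
  have h1 : fderiv ℝ (fun z => fderiv ℝ F z w) p v = fderiv ℝ (fderiv ℝ F) p v w := by
    rw [(hd.hasFDerivAt.clm_apply (hasFDerivAt_const w p)).fderiv]; simp
  have hcomp : ∀ z ∈ Ω, fderiv ℝ F z w = (pd w (fun z => (F z).1) z,
      pd w (fun z => (F z).2.1) z, pd w (fun z => (F z).2.2) z) := fun z hz =>
    fderiv_apply_components ((hF.contDiffAt (hΩ.mem_nhds hz)).differentiableAt (by simp)) w
  rw [← h1, fderiv_apply_components hD]
  refine Prod.ext ?_ (Prod.ext ?_ ?_)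
  · exact pd_congr hΩ (fun z hz => by simp only [hcomp z hz]) hp v
  · exact pd_congr hΩ (fun z hz => by simp only [hcomp z hz]) hp v
  · exact pd_congr hΩ (fun z hz => by simp only [hcomp z hz]) hp v

end Components

/-! ### The determining equations of admissible transformations -/

/-- A nonzero affine function of `(a, q)` is nonzero for at least two values of `q`, so a linear
function of `q` that vanishes wherever the affine function does not is zero. -/
theorem eq_zero_of_affine {m₀ m₁ m₂ α β : ℝ} (hm : ¬(m₀ = 0 ∧ m₁ = 0 ∧ m₂ = 0))
    (h : ∀ a q : ℝ, m₀ + q * m₁ + a * m₂ ≠ 0 → α + q * β = 0) : α = 0 ∧ β = 0 := by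
  have two : ∀ a q a' q' : ℝ, q ≠ q' → m₀ + q * m₁ + a * m₂ ≠ 0 →
      m₀ + q' * m₁ + a' * m₂ ≠ 0 → α = 0 ∧ β = 0 := by
    intro a q a' q' hq h1 h2
    have e1 := h a q h1
    have e2 := h a' q' h2
    have hβ : β = 0 := by
      have : (q - q') * β = 0 := by linear_combination e1 - e2
      exact (mul_eq_zero.1 this).resolve_left (sub_ne_zero.2 hq)
    refine ⟨?_, hβ⟩
    rw [hβ] at e1; linarith
  by_cases h2 : m₂ = 0
  · subst h2
    by_cases h1 : m₁ = 0
    · subst h1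
      have h0 : m₀ ≠ 0 := fun h0 => hm ⟨h0, rfl, rfl⟩
      exact two 0 0 0 1 (by norm_num) (by simpa using h0) (by simpa using h0)
    · refine two 0 ((1 - m₀) / m₁) 0 ((2 - m₀) / m₁) ?_ ?_ ?_
      · intro he
        rw [div_left_inj' h1] at he
        linarith
      · field_simp; norm_num
      · field_simp; norm_num
  · refine two ((1 - m₀) / m₂) 0 ((1 - m₀ - m₁) / m₂) 1 (by norm_num) ?_ ?_
    · field_simp; norm_num
    · field_simp; norm_num

section DeterminingEquations

variable {L L' : BurgersEq} {Ω : Set (ℝ × ℝ × ℝ)} {T X U : ℝ × ℝ × ℝ → ℝ}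

/-- The data shared by the derivation of the determining equations: an admissible transformation
with components `(T, X, U)` on an open set. -/
structure AdmissibleOn (L L' : BurgersEq) (T X U : ℝ × ℝ × ℝ → ℝ) (Ω : Set (ℝ × ℝ × ℝ)) :
    Prop where
  isOpen : IsOpen Ω
  smooth_T : ContDiffOn ℝ ∞ T Ω
  smooth_X : ContDiffOn ℝ ∞ X Ω
  smooth_U : ContDiffOn ℝ ∞ U Ω
  mem_source : ∀ p ∈ Ω, p.1 ∈ L.I
  mem_target : ∀ p ∈ Ω, T p ∈ L'.I
  admissible : IsAdmissible L L' (fun p => (T p, X p, U p)) Ω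

namespace AdmissibleOn

variable (H : AdmissibleOn L L' T X U Ω) {p : ℝ × ℝ × ℝ} (hp : p ∈ Ω)
include H hp

/-- The differentials of the components are linearly independent. -/
theorem jacobian {α β γ : ℝ} (h1 : α * ∂ₜ T p + β * ∂ₜ X p + γ * ∂ₜ U p = 0)
    (h2 : α * ∂ₓ T p + β * ∂ₓ X p + γ * ∂ₓ U p = 0)
    (h3 : α * ∂ᵤ T p + β * ∂ᵤ X p + γ * ∂ᵤ U p = 0) : α = 0 ∧ β = 0 ∧ γ = 0 := by
  obtain ⟨-, -, ⟨hF, hdet⟩, -⟩ := H.admissible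
  have hd := (hF.contDiffAt (H.isOpen.mem_nhds hp)).differentiableAt (by simp)
  have key : ∀ w : ℝ × ℝ × ℝ, α * w.1 + β * w.2.1 + γ * w.2.2 = 0 := by
    intro w
    obtain ⟨v, hv⟩ := exists_preimage_of_det_ne_zero _ (hdet p hp) w
    rw [← hv, fderiv_apply_components hd]
    obtain ⟨v1, v2, v3⟩ := v
    simp only [pd_eq_sum _ v1 v2 v3]
    linear_combination v1 * h1 + v2 * h2 + v3 * h3
  refine ⟨by simpa using key (1, 0, 0), by simpa using key (0, 1, 0), by simpa using key (0, 0, 1)⟩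

/-- `MapsEquation.jet_relations` in terms of the components. -/
theorem jet_relations {a q r : ℝ} (c : ℝ) (hrel : a + p.2.2 * q + L.h p.1 * p.2.2 = L.g p.1 * r)
    (hnd : (∂ₜ T p + a * ∂ᵤ T p) * (∂ₓ X p + q * ∂ᵤ X p)
      - (∂ₓ T p + q * ∂ᵤ T p) * (∂ₜ X p + a * ∂ᵤ X p) ≠ 0) :
    ∃ φ₁ φ₂ φ₂₂ : ℝ,
      ∂ₜ U p + a * ∂ᵤ U p = φ₁ * (∂ₜ T p + a * ∂ᵤ T p) + φ₂ * (∂ₜ X p + a * ∂ᵤ X p) ∧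
      ∂ₓ U p + q * ∂ᵤ U p = φ₁ * (∂ₓ T p + q * ∂ᵤ T p) + φ₂ * (∂ₓ X p + q * ∂ᵤ X p) ∧
      (∀ w₁ w₂ : ℝ, w₁ * (∂ₜ T p + a * ∂ᵤ T p) + w₂ * (∂ₓ T p + q * ∂ᵤ T p) = 0 →
        w₁ * (∂ₜ X p + a * ∂ᵤ X p) + w₂ * (∂ₓ X p + q * ∂ᵤ X p) = 1 → ∀ v,
        v = (w₁, w₂, a * w₁ + q * w₂) →
          pd v (pd v U) p + (r * w₂ ^ 2 + c * w₁ ^ 2) * ∂ᵤ U p =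
            φ₂₂ + φ₁ * (pd v (pd v T) p + (r * w₂ ^ 2 + c * w₁ ^ 2) * ∂ᵤ T p)
              + φ₂ * (pd v (pd v X) p + (r * w₂ ^ 2 + c * w₁ ^ 2) * ∂ᵤ X p)) ∧
      φ₁ + U p * φ₂ + L'.h (T p) * U p = L'.g (T p) * φ₂₂ := by
  obtain ⟨-, -, ⟨hF, -⟩, hm⟩ := H.admissible
  have hd := (hF.contDiffAt (H.isOpen.mem_nhds hp)).differentiableAt (by simp)
  have hD := fun v => fderiv_apply_components hd v
  have hDD := fun v w => fderiv_fderiv_apply_components hF H.isOpen hp v w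
  obtain ⟨t, x, u⟩ := p
  have ea : ∀ (Φ : ℝ × ℝ × ℝ → ℝ) z, pd (1, 0, a) Φ z = ∂ₜ Φ z + a * ∂ᵤ Φ z := by
    intro Φ z; rw [pd_eq_sum]; ring
  have eq : ∀ (Φ : ℝ × ℝ × ℝ → ℝ) z, pd (0, 1, q) Φ z = ∂ₓ Φ z + q * ∂ᵤ Φ z := by
    intro Φ z; rw [pd_eq_sum]; ring
  have er : ∀ (Φ : ℝ × ℝ × ℝ → ℝ) z s, pd (0, 0, s) Φ z = s * ∂ᵤ Φ z := by
    intro Φ z s; rw [pd_eq_sum]; ring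
  obtain ⟨φ₁, φ₂, φ₂₂, k1, k2, k3, k4⟩ := hm.jet_relations H.isOpen hF hp c hrel (by
    rw [hD, hD]; simp only [ea, eq]; exact hnd)
  refine ⟨φ₁, φ₂, φ₂₂, ?_, ?_, ?_, k4⟩
  · rw [hD] at k1; simpa only [ea] using k1
  · rw [hD] at k2; simpa only [eq] using k2
  · rintro w₁ w₂ hw1 hw2 v rfl
    rw [hD, hD] at k3
    simp only [ea, eq] at k3
    have := k3 w₁ w₂ hw1 hw2 _ rfl
    rw [hD, hDD] at this
    simpa only [er _ _ (r * w₂ ^ 2 + c * w₁ ^ 2), Prod.mk_add_mk] using this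

/-- The new time depends on the old time only. Changing `f_tt` by `c` at a point does not affect
the equation `L`, but it changes `f'_{xx}` by a multiple of `c * (T_x + T_u f_x) ^ 2`. -/
theorem time_vertical : ∂ₓ T p = 0 ∧ ∂ᵤ T p = 0 := by
  refine eq_zero_of_affine (m₀ := ∂ₜ T p * ∂ₓ X p - ∂ₓ T p * ∂ₜ X p)
    (m₁ := ∂ₜ T p * ∂ᵤ X p - ∂ᵤ T p * ∂ₜ X p) (m₂ := ∂ᵤ T p * ∂ₓ X p - ∂ₓ T p * ∂ᵤ X p) ?_ ?_
  · rintro ⟨m0, m1, m2⟩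
    have h1 := H.jacobian hp (α := ∂ₓ X p) (β := -∂ₓ T p) (γ := 0) (by linear_combination m0)
      (by ring) (by linear_combination m2)
    have h2 := H.jacobian hp (α := ∂ₜ X p) (β := -∂ₜ T p) (γ := 0) (by ring)
      (by linear_combination -m0) (by linear_combination -m1)
    have h3 := H.jacobian hp (α := ∂ᵤ X p) (β := -∂ᵤ T p) (γ := 0) (by linear_combination m1)
      (by linear_combination -m2) (by ring)
    have h4 := H.jacobian hp (α := 1) (β := 0) (γ := 0) (by linarith [h2.2.1])
      (by linarith [h1.2.1]) (by linarith [h3.2.1])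
    exact one_ne_zero h4.1
  · intro a q hN
    have hnd : (∂ₜ T p + a * ∂ᵤ T p) * (∂ₓ X p + q * ∂ᵤ X p)
      - (∂ₓ T p + q * ∂ᵤ T p) * (∂ₜ X p + a * ∂ᵤ X p) ≠ 0 := by
      intro h0; apply hN; linear_combination h0
    have hg := L.g_ne_zero _ (H.mem_source p hp)
    have hg' := L'.g_ne_zero _ (H.mem_target p hp)
    have hrel : a + p.2.2 * q + L.h p.1 * p.2.2
        = L.g p.1 * ((a + p.2.2 * q + L.h p.1 * p.2.2) / L.g p.1) := by field_simp
    obtain ⟨φ₁, φ₂, φ₂₂, k1, k2, k3, k4⟩ := H.jet_relations hp 0 hrel hnd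
    obtain ⟨ψ₁, ψ₂, ψ₂₂, l1, l2, l3, l4⟩ := H.jet_relations hp 1 hrel hnd
    set a11 := ∂ₜ T p + a * ∂ᵤ T p
    set a12 := ∂ₜ X p + a * ∂ᵤ X p
    set a21 := ∂ₓ T p + q * ∂ᵤ T p
    set a22 := ∂ₓ X p + q * ∂ᵤ X p
    have e1 : φ₁ = ψ₁ := by
      refine sub_eq_zero.1 ((mul_eq_zero.1 ?_).resolve_right hnd)
      linear_combination a22 * (l1 - k1) - a12 * (l2 - k2)
    have e2 : φ₂ = ψ₂ := by
      refine sub_eq_zero.1 ((mul_eq_zero.1 ?_).resolve_right hnd)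
      linear_combination a11 * (l2 - k2) - a21 * (l1 - k1)
    subst e1 e2
    -- the first-order jets of the images agree, hence by `L'` and `g' ≠ 0` so do the `f'_xx`
    have e22 : φ₂₂ = ψ₂₂ := mul_left_cancel₀ hg' (k4.symm.trans l4)
    subst e22
    obtain ⟨Δ, hΔ⟩ : ∃ Δ, Δ = a11 * a22 - a21 * a12 := ⟨_, rfl⟩
    rw [← hΔ] at hnd
    have w1 : -a21 / Δ * a11 + a11 / Δ * a21 = 0 := by ring
    have w2 : -a21 / Δ * a12 + a11 / Δ * a22 = 1 := by
      field_simp; linear_combination -hΔ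
    have d0 := k3 _ _ w1 w2 _ rfl
    have d1 := l3 _ _ w1 w2 _ rfl
    have d2 : (-a21 / Δ) ^ 2 * (∂ᵤ U p - φ₁ * ∂ᵤ T p - φ₂ * ∂ᵤ X p) = 0 := by
      linear_combination d1 - d0
    rcases mul_eq_zero.1 d2 with d3 | d3
    · have := pow_eq_zero_iff (two_ne_zero) |>.1 d3
      rw [div_eq_zero_iff] at this
      have := this.resolve_right hnd
      linarith
    · exfalso
      have := H.jacobian hp (α := -φ₁) (β := -φ₂) (γ := 1)
        (by linear_combination k1 - a * d3) (by linear_combination k2 - q * d3)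
        (by linear_combination d3)
      exact one_ne_zero this.2.2

theorem pt_T_ne_zero : ∂ₜ T p ≠ 0 := by
  intro h
  obtain ⟨hx, hu⟩ := H.time_vertical hp
  exact one_ne_zero (H.jacobian hp (α := 1) (β := 0) (γ := 0) (by rw [h]; ring) (by rw [hx]; ring)
    (by rw [hu]; ring)).1

theorem pd_pd_time_vertical (β γ : ℝ) : pd (0, β, γ) (pd (0, β, γ) T) p = 0 := by
  rw [pd_pd_vertical H.smooth_T H.isOpen hp,
    pd_zero_of_eqOn H.isOpen (fun z hz => (H.time_vertical hz).1) hp,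
    pd_zero_of_eqOn H.isOpen (fun z hz => (H.time_vertical hz).2) hp,
    pd_zero_of_eqOn H.isOpen (fun z hz => (H.time_vertical hz).2) hp]
  ring

/-- The determining relation, for an arbitrary jet of the source equation: `q` stands for `f_x`
and `r` for `f_xx`. -/
theorem vertical_relation (q r : ℝ) (hm : ∂ₓ X p + q * ∂ᵤ X p ≠ 0) :
    ∃ φ₁ φ₂ a : ℝ, a = L.g p.1 * r - p.2.2 * q - L.h p.1 * p.2.2 ∧
      φ₂ * (∂ₓ X p + q * ∂ᵤ X p) = ∂ₓ U p + q * ∂ᵤ U p ∧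
      φ₁ * ∂ₜ T p = ∂ₜ U p + a * ∂ᵤ U p - φ₂ * (∂ₜ X p + a * ∂ᵤ X p) ∧
      (φ₁ + U p * φ₂ + L'.h (T p) * U p) * (∂ₓ X p + q * ∂ᵤ X p) ^ 2
        = L'.g (T p) * (∂ₓ (∂ₓ U) p + 2 * q * ∂ₓ (∂ᵤ U) p + q ^ 2 * ∂ᵤ (∂ᵤ U) p + r * ∂ᵤ U p
          - φ₂ * (∂ₓ (∂ₓ X) p + 2 * q * ∂ₓ (∂ᵤ X) p + q ^ 2 * ∂ᵤ (∂ᵤ X) p + r * ∂ᵤ X p)) := by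
  obtain ⟨hx, hu⟩ := H.time_vertical hp
  have hT := H.pt_T_ne_zero hp
  obtain ⟨a, ha⟩ : ∃ a, a = L.g p.1 * r - p.2.2 * q - L.h p.1 * p.2.2 := ⟨_, rfl⟩
  obtain ⟨φ₁, φ₂, φ₂₂, k1, k2, k3, k4⟩ := H.jet_relations hp (a := a) (q := q) (r := r) 0
    (by rw [ha]; ring) (by rw [hx, hu]; simpa using ⟨hT, hm⟩)
  obtain ⟨m, hmdef⟩ : ∃ m, m = ∂ₓ X p + q * ∂ᵤ X p := ⟨_, rfl⟩
  rw [← hmdef] at hm k2 k3 ⊢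
  have k5 := k3 0 (1 / m) (by rw [hx, hu]; ring) (by field_simp; ring) _ rfl
  rw [mul_zero, zero_add, H.pd_pd_time_vertical hp, pd_pd_vertical H.smooth_X H.isOpen hp,
    pd_pd_vertical H.smooth_U H.isOpen hp, hu] at k5
  refine ⟨φ₁, φ₂, a, ha, ?_, ?_, ?_⟩
  · rw [k2, hx, hu]; ring
  · rw [hu] at k1; linear_combination -k1
  · rw [k4]
    field_simp at k5
    linear_combination -L'.g (T p) * k5

/-- The coefficient of `f_xx` in the determining relation. -/
theorem space_relation : ∂ᵤ X p = 0 ∧ ∂ₓ X p ≠ 0 ∧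
    L.g p.1 * ∂ₓ X p ^ 2 = L'.g (T p) * ∂ₜ T p := by
  obtain ⟨hx, hu⟩ := H.time_vertical hp
  have hT := H.pt_T_ne_zero hp
  have key : ∀ q, ∂ₓ X p + q * ∂ᵤ X p ≠ 0 →
      L.g p.1 * (∂ₓ X p + q * ∂ᵤ X p) ^ 2 = L'.g (T p) * ∂ₜ T p := by
    intro q hm
    obtain ⟨φ₁, φ₂, a, ha, k1, k2, k3⟩ := H.vertical_relation hp q 0 hm
    -- increase `f_xx` by `1`, and hence `f_t` by `g`
    obtain ⟨ψ₁, ψ₂, b, hb, l1, l2, l3⟩ := H.vertical_relation hp q 1 hm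
    have e : φ₂ = ψ₂ := mul_right_cancel₀ hm (k1.trans l1.symm)
    subst e
    have hκ : ∂ᵤ U p - φ₂ * ∂ᵤ X p ≠ 0 := by
      intro h0
      have := H.jacobian hp (α := -φ₁) (β := -φ₂) (γ := 1)
        (by linear_combination -k2 - a * h0)
        (by rw [hx]; linear_combination -k1 - q * h0)
        (by rw [hu]; linear_combination h0)
      exact one_ne_zero this.2.2
    refine mul_right_cancel₀ hκ ?_
    have hba : b - a = L.g p.1 := by rw [ha, hb]; ring
    rw [← hba]
    linear_combination ∂ₜ T p * (l3 - k3) - (∂ₓ X p + q * ∂ᵤ X p) ^ 2 * (l2 - k2)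
  have hg := L.g_ne_zero _ (H.mem_source p hp)
  have hX : ∂ᵤ X p = 0 := by
    by_contra h3
    -- values of `f_x` for which the total derivative of `X` is `1` and `2`
    have e1 : ∂ₓ X p + (1 - ∂ₓ X p) / ∂ᵤ X p * ∂ᵤ X p = 1 := by field_simp; ring
    have e2 : ∂ₓ X p + (2 - ∂ₓ X p) / ∂ᵤ X p * ∂ᵤ X p = 2 := by field_simp; ring
    have k1 := key ((1 - ∂ₓ X p) / ∂ᵤ X p) (by rw [e1]; norm_num)
    have k2 := key ((2 - ∂ₓ X p) / ∂ᵤ X p) (by rw [e2]; norm_num)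
    rw [e1] at k1
    rw [e2] at k2
    exact hg (by linarith)
  have hX2 : ∂ₓ X p ≠ 0 := by
    intro h2
    have := H.jacobian hp (α := ∂ₜ X p) (β := -∂ₜ T p) (γ := 0) (by ring)
      (by rw [hx, h2]; ring) (by rw [hu, hX]; ring)
    exact hT (by linarith [this.2.1])
  refine ⟨hX, hX2, ?_⟩
  have := key 0 (by simpa using hX2)
  simpa using this

/-- By `space_relation`, the square of `X_x` depends on `t` only. -/
theorem px_px_X : ∂ₓ (∂ₓ X) p = 0 := by
  have hg := L.g_ne_zero _ (H.mem_source p hp)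
  have hX := (H.space_relation hp).2.1
  have hX2 := contDiffOn_pd H.smooth_X H.isOpen (0, 1, 0)
  have hT1 := contDiffOn_pd H.smooth_T H.isOpen (1, 0, 0)
  have dX2 := hX2.differentiableAt_infty H.isOpen hp
  have dT1 := hT1.differentiableAt_infty H.isOpen hp
  have dT := H.smooth_T.differentiableAt_infty H.isOpen hp
  have dg : DifferentiableAt ℝ L.g p.1 :=
    (L.smooth_g.contDiffAt (L.isOpen_I.mem_nhds (H.mem_source p hp))).differentiableAt (by simp)
  have dg' : DifferentiableAt ℝ L'.g (T p) :=
    (L'.smooth_g.contDiffAt (L'.isOpen_I.mem_nhds (H.mem_target p hp))).differentiableAt (by simp)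
  have key := pd_congr H.isOpen (Φ := fun z => L.g z.1 * (∂ₓ X z * ∂ₓ X z))
    (Ψ := fun z => L'.g (T z) * ∂ₜ T z)
    (fun z hz => by
      have := (H.space_relation hz).2.2
      simp only
      linear_combination this) hp (0, 1, 0)
  have hTT : ∂ₓ (∂ₜ T) p = 0 := by
    rw [pd_comm H.smooth_T H.isOpen hp]
    exact pd_zero_of_eqOn H.isOpen (fun z hz => (H.time_vertical hz).1) hp _
  rw [pd_mul (Φ := fun z => L.g z.1) (dg.comp p differentiableAt_fst) (dX2.fun_mul dX2),
    pd_mul (Φ := fun z => L'.g (T z)) (dg'.comp p dT) dT1, pd_comp_fst dg, pd_mul dX2 dX2,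
    pd_comp dg' dT, (H.time_vertical hp).1, hTT] at key
  have : (2 * L.g p.1 * ∂ₓ X p) * ∂ₓ (∂ₓ X) p = 0 := by linear_combination key
  simpa [hg, hX] using this

/-- The coefficients of the powers of `f_x` in the determining relation. -/
theorem velocity_relations : ∂ᵤ U p ≠ 0 ∧ ∂ᵤ (∂ᵤ U) p = 0 ∧
    ∂ₜ T p * U p * ∂ᵤ U p = ∂ₓ X p * p.2.2 * ∂ᵤ U p + ∂ₜ X p * ∂ᵤ U p
      + 2 * L.g p.1 * ∂ₓ X p * ∂ₓ (∂ᵤ U) p ∧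
    ((∂ₜ U p - L.h p.1 * p.2.2 * ∂ᵤ U p) * ∂ₓ X p - ∂ₓ U p * ∂ₜ X p) * ∂ₓ X p
      + ∂ₜ T p * (U p * ∂ₓ U p * ∂ₓ X p + L'.h (T p) * U p * ∂ₓ X p ^ 2)
      = L'.g (T p) * ∂ₜ T p * ∂ₓ (∂ₓ U) p := by
  obtain ⟨hx, hu⟩ := H.time_vertical hp
  have hT := H.pt_T_ne_zero hp
  obtain ⟨hX3, hX2, hgg⟩ := H.space_relation hp
  have hg' := L'.g_ne_zero _ (H.mem_target p hp)
  have hX33 : ∂ᵤ (∂ᵤ X) p = 0 := pd_zero_of_eqOn H.isOpen (fun z hz => (H.space_relation hz).1) hp _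
  have hX23 : ∂ₓ (∂ᵤ X) p = 0 := pd_zero_of_eqOn H.isOpen (fun z hz => (H.space_relation hz).1) hp _
  have hX22 := H.px_px_X hp
  have hU3 : ∂ᵤ U p ≠ 0 := by
    intro h3
    obtain ⟨φ₁, φ₂, a, ha, k1, k2, k3⟩ := H.vertical_relation hp 0 0 (by simpa using hX2)
    rw [hX3, h3] at k1 k2
    have := H.jacobian hp (α := -φ₁) (β := -φ₂) (γ := 1)
      (by linear_combination -k2) (by rw [hx]; linear_combination -k1) (by rw [hu, hX3, h3]; ring)
    exact one_ne_zero this.2.2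
  have key : ∀ q : ℝ,
      ((∂ₜ U p - (p.2.2 * q + L.h p.1 * p.2.2) * ∂ᵤ U p) * ∂ₓ X p
        - (∂ₓ U p + q * ∂ᵤ U p) * ∂ₜ X p) * ∂ₓ X p
        + ∂ₜ T p * (U p * (∂ₓ U p + q * ∂ᵤ U p) * ∂ₓ X p + L'.h (T p) * U p * ∂ₓ X p ^ 2)
      = L'.g (T p) * ∂ₜ T p * (∂ₓ (∂ₓ U) p + 2 * q * ∂ₓ (∂ᵤ U) p + q ^ 2 * ∂ᵤ (∂ᵤ U) p) := by
    intro q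
    obtain ⟨φ₁, φ₂, a, ha, k1, k2, k3⟩ := H.vertical_relation hp q 0 (by simpa [hX3] using hX2)
    rw [hX3, hX33, hX23, hX22] at k3
    rw [hX3] at k1 k2
    subst ha
    linear_combination ∂ₜ T p * k3 - ∂ₓ X p ^ 2 * k2 - ∂ₜ T p * U p * ∂ₓ X p * k1
      + ∂ₓ X p * ∂ₜ X p * k1
  -- three values of `q` separate the coefficients of the quadratic polynomial
  have k0 := key 0
  have k1 := key 1
  have k2 := key (-1)
  refine ⟨hU3, ?_, ?_, ?_⟩
  · have : (L'.g (T p) * ∂ₜ T p) * (2 * ∂ᵤ (∂ᵤ U) p) = 0 := by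
      linear_combination 2 * k0 - k1 - k2
    simpa [hg', hT] using this
  · refine mul_left_cancel₀ hX2 ?_
    linear_combination (1 / 2) * (k1 - k2) - 2 * ∂ₓ (∂ᵤ U) p * hgg
  · linear_combination k0

/-- This is the derivative in `u` of the third of the `velocity_relations`, where the derivatives of
`T_t`, `X_t`, `X_x`, `U_u` and `U_xu` in `u` vanish. -/
theorem pt_T_mul_pu_U : ∂ₜ T p * ∂ᵤ U p = ∂ₓ X p := by
  obtain ⟨hU3, hU33, -, -⟩ := H.velocity_relations hp
  obtain ⟨hX3, hX2, -⟩ := H.space_relation hp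
  have dg : DifferentiableAt ℝ L.g p.1 :=
    (L.smooth_g.contDiffAt (L.isOpen_I.mem_nhds (H.mem_source p hp))).differentiableAt (by simp)
  have dT1 := (contDiffOn_pd H.smooth_T H.isOpen (1, 0, 0)).differentiableAt_infty H.isOpen hp
  have dU := H.smooth_U.differentiableAt_infty H.isOpen hp
  have sU3 := contDiffOn_pd H.smooth_U H.isOpen (0, 0, 1)
  have dU3 := sU3.differentiableAt_infty H.isOpen hp
  have dU23 := (contDiffOn_pd sU3 H.isOpen (0, 1, 0)).differentiableAt_infty H.isOpen hp
  have dX1 := (contDiffOn_pd H.smooth_X H.isOpen (1, 0, 0)).differentiableAt_infty H.isOpen hp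
  have dX2 := (contDiffOn_pd H.smooth_X H.isOpen (0, 1, 0)).differentiableAt_infty H.isOpen hp
  have du : DifferentiableAt ℝ (fun z : ℝ × ℝ × ℝ => z.2.2) p := by fun_prop
  have dgf : DifferentiableAt ℝ (fun z : ℝ × ℝ × ℝ => L.g z.1) p := dg.comp p differentiableAt_fst
  have key := pd_congr H.isOpen (Φ := fun z => ∂ₜ T z * U z * ∂ᵤ U z)
    (Ψ := fun z => (∂ₓ X z * z.2.2 * ∂ᵤ U z + ∂ₜ X z * ∂ᵤ U z)
      + 2 * (L.g z.1 * ∂ₓ X z * ∂ₓ (∂ᵤ U) z))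
    (fun z hz => by
      have := (H.velocity_relations hz).2.2.1
      simp only
      linear_combination this) hp (0, 0, 1)
  have hT13 : ∂ᵤ (∂ₜ T) p = 0 := by
    rw [pd_comm H.smooth_T H.isOpen hp]
    exact pd_zero_of_eqOn H.isOpen (fun z hz => (H.time_vertical hz).2) hp _
  have hX13 : ∂ᵤ (∂ₜ X) p = 0 := by
    rw [pd_comm H.smooth_X H.isOpen hp]
    exact pd_zero_of_eqOn H.isOpen (fun z hz => (H.space_relation hz).1) hp _
  have hX23 : ∂ᵤ (∂ₓ X) p = 0 := by
    rw [pd_comm H.smooth_X H.isOpen hp]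
    exact pd_zero_of_eqOn H.isOpen (fun z hz => (H.space_relation hz).1) hp _
  have hU233 : ∂ᵤ (∂ₓ (∂ᵤ U)) p = 0 := by
    rw [pd_comm sU3 H.isOpen hp]
    exact pd_zero_of_eqOn H.isOpen (fun z hz => (H.velocity_relations hz).2.1) hp _
  rw [pd_mul (dT1.fun_mul dU) dU3, pd_mul dT1 dU,
    pd_add (((dX2.fun_mul du).fun_mul dU3).fun_add (dX1.fun_mul dU3)) (((dgf.fun_mul dX2).fun_mul dU23).const_mul 2),
    pd_add ((dX2.fun_mul du).fun_mul dU3) (dX1.fun_mul dU3), pd_mul (dX2.fun_mul du) dU3, pd_mul dX2 du,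
    pd_mul dX1 dU3, pd_const_mul ((dgf.fun_mul dX2).fun_mul dU23), pd_mul (dgf.fun_mul dX2) dU23,
    pd_mul dgf dX2, pd_comp_fst dg, pd_u, hT13, hX13, hX23, hU233, hU33] at key
  refine mul_right_cancel₀ hU3 ?_
  linear_combination key

theorem px_pu_U : ∂ₓ (∂ᵤ U) p = 0 := by
  have dT1 := (contDiffOn_pd H.smooth_T H.isOpen (1, 0, 0)).differentiableAt_infty H.isOpen hp
  have dU3 := (contDiffOn_pd H.smooth_U H.isOpen (0, 0, 1)).differentiableAt_infty H.isOpen hp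
  have key := pd_congr H.isOpen (Φ := fun z => ∂ₜ T z * ∂ᵤ U z) (Ψ := ∂ₓ X)
    (fun z hz => H.pt_T_mul_pu_U hz) hp (0, 1, 0)
  have hTT : ∂ₓ (∂ₜ T) p = 0 := by
    rw [pd_comm H.smooth_T H.isOpen hp]
    exact pd_zero_of_eqOn H.isOpen (fun z hz => (H.time_vertical hz).1) hp _
  rw [pd_mul dT1 dU3, H.px_px_X hp, hTT] at key
  have : ∂ₜ T p * ∂ₓ (∂ᵤ U) p = 0 := by linear_combination key
  exact (mul_eq_zero.1 this).resolve_left (H.pt_T_ne_zero hp)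

/-- The new velocity is `dX / dT` along curves with `dx / dt = u`. -/
theorem pt_T_mul_U : ∂ₜ T p * U p = ∂ₓ X p * p.2.2 + ∂ₜ X p := by
  obtain ⟨hU3, -, h, -⟩ := H.velocity_relations hp
  rw [H.px_pu_U hp] at h
  refine mul_right_cancel₀ hU3 ?_
  linear_combination h

end AdmissibleOn

end DeterminingEquations

/-! ### The normal form of admissible transformations -/

/-- The transformation `t' = T(t)`, `x' = A(t) x + B(t)`, extended to `u` as to a velocity:
`u' = dx' / dt'` for `u = dx / dt`. -/
noncomputable def affineMap (T A B : ℝ → ℝ) (p : ℝ × ℝ × ℝ) : ℝ × ℝ × ℝ :=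
  (T p.1, A p.1 * p.2.1 + B p.1,
    (A p.1 * p.2.2 + deriv A p.1 * p.2.1 + deriv B p.1) / deriv T p.1)

/-- The conditions under which `affineMap T A B` maps the equation `L` to the equation `L'`, over
the set `J` of values of `t`. -/
structure IsNormalForm (L L' : BurgersEq) (T A B : ℝ → ℝ) (J : Set ℝ) : Prop where
  smooth_T : ContDiffOn ℝ ∞ T J
  smooth_A : ContDiffOn ℝ ∞ A J
  smooth_B : ContDiffOn ℝ ∞ B J
  deriv_T_ne_zero : ∀ t ∈ J, deriv T t ≠ 0
  A_ne_zero : ∀ t ∈ J, A t ≠ 0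
  ode_A : ∀ t ∈ J, deriv (deriv A) t = (2 * (deriv A t / A t) - L.h t) * deriv A t
  ode_B : ∀ t ∈ J, deriv (deriv B) t = (2 * (deriv A t / A t) - L.h t) * deriv B t
  h_rule : ∀ t ∈ J, L'.h (T t) =
    (L.h t + deriv (deriv T) t / deriv T t - 2 * (deriv A t / A t)) / deriv T t
  g_rule : ∀ t ∈ J, L'.g (T t) = A t ^ 2 / deriv T t * L.g t

section Smooth

variable {J : Set ℝ} {f : ℝ → ℝ} {t : ℝ}

theorem ContDiffOn.hasDerivAt_infty (hf : ContDiffOn ℝ ∞ f J) (hJ : IsOpen J) (ht : t ∈ J) :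
    HasDerivAt f (deriv f t) t :=
  ((hf.contDiffAt (hJ.mem_nhds ht)).differentiableAt (by simp)).hasDerivAt

theorem ContDiffOn.deriv_infty (hf : ContDiffOn ℝ ∞ f J) (hJ : IsOpen J) :
    ContDiffOn ℝ ∞ (deriv f) J :=
  hf.deriv_of_isOpen hJ (by simp)

end Smooth

section AffineComponents

variable {Ω : Set (ℝ × ℝ × ℝ)} {T A B : ℝ → ℝ} {X U : ℝ × ℝ × ℝ → ℝ} {p : ℝ × ℝ × ℝ}

theorem pd_space_component (hΩ : IsOpen Ω) (hp : p ∈ Ω)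
    (hX : ∀ p ∈ Ω, X p = A p.1 * p.2.1 + B p.1)
    (hA : DifferentiableAt ℝ A p.1) (hB : DifferentiableAt ℝ B p.1) (v : ℝ × ℝ × ℝ) :
    pd v X p = v.1 * deriv A p.1 * p.2.1 + A p.1 * v.2.1 + v.1 * deriv B p.1 := by
  have dA : DifferentiableAt ℝ (fun z : ℝ × ℝ × ℝ => A z.1) p := hA.comp p differentiableAt_fst
  have dB : DifferentiableAt ℝ (fun z : ℝ × ℝ × ℝ => B z.1) p := hB.comp p differentiableAt_fst
  have dx : DifferentiableAt ℝ (fun z : ℝ × ℝ × ℝ => z.2.1) p := by fun_prop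
  rw [pd_congr hΩ (Ψ := fun z => A z.1 * z.2.1 + B z.1) hX hp, pd_add (dA.fun_mul dx) dB,
    pd_mul dA dx, pd_comp_fst hA, pd_comp_fst hB, pd_x]

theorem pd_velocity_component (hΩ : IsOpen Ω) (hp : p ∈ Ω)
    (hU : ∀ p ∈ Ω, deriv T p.1 * U p = A p.1 * p.2.2 + deriv A p.1 * p.2.1 + deriv B p.1)
    (hA : DifferentiableAt ℝ A p.1) (hA' : DifferentiableAt ℝ (deriv A) p.1)
    (hB' : DifferentiableAt ℝ (deriv B) p.1) (hT' : DifferentiableAt ℝ (deriv T) p.1)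
    (hUd : DifferentiableAt ℝ U p) (v : ℝ × ℝ × ℝ) :
    v.1 * deriv (deriv T) p.1 * U p + deriv T p.1 * pd v U p
      = v.1 * deriv A p.1 * p.2.2 + A p.1 * v.2.2 + v.1 * deriv (deriv A) p.1 * p.2.1
        + deriv A p.1 * v.2.1 + v.1 * deriv (deriv B) p.1 := by
  have dA : DifferentiableAt ℝ (fun z : ℝ × ℝ × ℝ => A z.1) p := hA.comp p differentiableAt_fst
  have dA' : DifferentiableAt ℝ (fun z : ℝ × ℝ × ℝ => deriv A z.1) p :=
    hA'.comp p differentiableAt_fst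
  have dB' : DifferentiableAt ℝ (fun z : ℝ × ℝ × ℝ => deriv B z.1) p :=
    hB'.comp p differentiableAt_fst
  have dT' : DifferentiableAt ℝ (fun z : ℝ × ℝ × ℝ => deriv T z.1) p :=
    hT'.comp p differentiableAt_fst
  have dx : DifferentiableAt ℝ (fun z : ℝ × ℝ × ℝ => z.2.1) p := by fun_prop
  have du : DifferentiableAt ℝ (fun z : ℝ × ℝ × ℝ => z.2.2) p := by fun_prop
  have key := pd_congr hΩ (Φ := fun z => deriv T z.1 * U z)
    (Ψ := fun z => (A z.1 * z.2.2 + deriv A z.1 * z.2.1) + deriv B z.1) hU hp v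
  rw [pd_mul dT' hUd, pd_comp_fst hT', pd_add ((dA.fun_mul du).fun_add (dA'.fun_mul dx)) dB',
    pd_add (dA.fun_mul du) (dA'.fun_mul dx), pd_mul dA du, pd_mul dA' dx, pd_comp_fst hA,
    pd_comp_fst hA', pd_comp_fst hB', pd_x, pd_u] at key
  linear_combination key

end AffineComponents

theorem isOpen_image_fst {Ω : Set (ℝ × ℝ × ℝ)} (hΩ : IsOpen Ω) : IsOpen (Prod.fst '' Ω) :=
  isOpenMap_fst Ω hΩ

/-- An affine function of `(x, u)` that vanishes near a point is zero. -/
theorem eq_zero_of_affine_eqOn {Ω : Set (ℝ × ℝ × ℝ)} (hΩ : IsOpen Ω) {p : ℝ × ℝ × ℝ} (hp : p ∈ Ω)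
    {α β κ : ℝ} (h : ∀ x u : ℝ, (p.1, x, u) ∈ Ω → α * u + β * x + κ = 0) :
    α = 0 ∧ β = 0 ∧ κ = 0 := by
  obtain ⟨t, x, u⟩ := p
  have h0 := h x u hp
  have near : ∀ v : ℝ × ℝ × ℝ, ∃ s : ℝ, s ≠ 0 ∧ (t, x, u) + s • v ∈ Ω := by
    intro v
    have hc : Continuous fun s : ℝ => (t, x, u) + s • v := by fun_prop
    have h1 : ∀ᶠ s in 𝓝 (0 : ℝ), (t, x, u) + s • v ∈ Ω :=
      hc.continuousAt.eventually (hΩ.mem_nhds (by simpa using hp))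
    obtain ⟨s, hs, hs'⟩ := ((h1.filter_mono nhdsWithin_le_nhds).and
      (self_mem_nhdsWithin : {(0 : ℝ)}ᶜ ∈ 𝓝[≠] 0)).exists
    exact ⟨s, hs', hs⟩
  have hα : α = 0 := by
    obtain ⟨s, hs, hsΩ⟩ := near (0, 0, 1)
    have h1 := h x (u + s) (by simpa using hsΩ)
    have : α * s = 0 := by linear_combination h1 - h0
    exact (mul_eq_zero.1 this).resolve_right hs
  have hβ : β = 0 := by
    obtain ⟨s, hs, hsΩ⟩ := near (0, 1, 0)
    have h1 := h (x + s) u (by simpa using hsΩ)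
    have : β * s = 0 := by linear_combination h1 - h0
    exact (mul_eq_zero.1 this).resolve_right hs
  refine ⟨hα, hβ, ?_⟩
  rw [hα, hβ] at h0
  simpa using h0

/-- On a convex open set, every admissible transformation has the normal form. -/
theorem IsAdmissible.exists_isNormalForm {L L' : BurgersEq} {F : ℝ × ℝ × ℝ → ℝ × ℝ × ℝ}
    {Ω : Set (ℝ × ℝ × ℝ)} (hΩ : IsOpen Ω) (hc : Convex ℝ Ω) (hF : IsAdmissible L L' F Ω) :
    ∃ T A B : ℝ → ℝ, IsNormalForm L L' T A B (Prod.fst '' Ω) ∧ Set.EqOn F (affineMap T A B) Ω := by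
  obtain ⟨τ, hτ⟩ : ∃ τ : ℝ × ℝ × ℝ → ℝ, τ = fun p => (F p).1 := ⟨_, rfl⟩
  obtain ⟨X, hX⟩ : ∃ X : ℝ × ℝ × ℝ → ℝ, X = fun p => (F p).2.1 := ⟨_, rfl⟩
  obtain ⟨U, hU⟩ : ∃ U : ℝ × ℝ × ℝ → ℝ, U = fun p => (F p).2.2 := ⟨_, rfl⟩
  have hFc : F = fun p => (τ p, X p, U p) := by rw [hτ, hX, hU]
  have hFs := hF.2.2.1.1
  have H : AdmissibleOn L L' τ X U Ω :=
    { isOpen := hΩ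
      smooth_T := by rw [hτ]; exact hFs.fst
      smooth_X := by rw [hX]; exact hFs.snd.fst
      smooth_U := by rw [hU]; exact hFs.snd.snd
      mem_source := fun p hp => hF.1 hp
      mem_target := fun p hp => by rw [hτ]; exact hF.2.1 hp
      admissible := by rw [← hFc]; exact hF }
  have hJ := isOpen_image_fst hΩ
  have sX2 := contDiffOn_pd H.smooth_X hΩ (0, 1, 0)
  have dX2 : ∀ p ∈ Ω, DifferentiableAt ℝ (∂ₓ X) p := fun p hp => sX2.differentiableAt_infty hΩ hp
  have dX : ∀ p ∈ Ω, DifferentiableAt ℝ X p := fun p hp => H.smooth_X.differentiableAt_infty hΩ hp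
  have hX23 : ∀ p ∈ Ω, ∂ᵤ (∂ₓ X) p = 0 := by
    intro p hp
    rw [pd_comm H.smooth_X hΩ hp]
    exact pd_zero_of_eqOn hΩ (fun z hz => (H.space_relation hz).1) hp _
  obtain ⟨T, sT, hT⟩ := exists_function_of_t hΩ hc H.smooth_T
    (fun p hp => (H.time_vertical hp).1) (fun p hp => (H.time_vertical hp).2)
  obtain ⟨A, sA, hA⟩ := exists_function_of_t hΩ hc sX2 (fun p hp => H.px_px_X hp) hX23
  have dx : ∀ p, DifferentiableAt ℝ (fun z : ℝ × ℝ × ℝ => (-1 : ℝ) * z.2.1) p := by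
    intro p; fun_prop
  have dx' : ∀ p, DifferentiableAt ℝ (fun z : ℝ × ℝ × ℝ => z.2.1) p := by
    intro p; fun_prop
  obtain ⟨B, sB, hB⟩ := exists_function_of_t (Φ := fun z => X z + (-1) * z.2.1 * ∂ₓ X z) hΩ hc
    (H.smooth_X.add (ContDiffOn.mul (by fun_prop) sX2))
    (fun p hp => by
      rw [pd_add (dX p hp) ((dx p).fun_mul (dX2 p hp)), pd_mul (dx p) (dX2 p hp),
        pd_const_mul (dx' p), pd_x, H.px_px_X hp]
      simp)
    (fun p hp => by
      rw [pd_add (dX p hp) ((dx p).fun_mul (dX2 p hp)), pd_mul (dx p) (dX2 p hp),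
        pd_const_mul (dx' p), pd_x, hX23 p hp, (H.space_relation hp).1]
      simp)
  have mJ : ∀ p ∈ Ω, p.1 ∈ Prod.fst '' Ω := fun p hp => ⟨p, hp, rfl⟩
  have hXform : ∀ p ∈ Ω, X p = A p.1 * p.2.1 + B p.1 := by
    intro p hp; rw [hA p hp, hB p hp]; ring
  have hX1 : ∀ p ∈ Ω, ∂ₜ X p = deriv A p.1 * p.2.1 + deriv B p.1 := by
    intro p hp
    rw [pd_space_component hΩ hp hXform (sA.hasDerivAt_infty hJ (mJ p hp)).differentiableAt
      (sB.hasDerivAt_infty hJ (mJ p hp)).differentiableAt]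
    ring
  have hT1 : ∀ p ∈ Ω, ∂ₜ τ p = deriv T p.1 := by
    intro p hp
    rw [pd_congr hΩ (Ψ := fun z => T z.1) (fun z hz => (hT z hz).symm) hp,
      pd_comp_fst (sT.hasDerivAt_infty hJ (mJ p hp)).differentiableAt]
    ring
  have hUform : ∀ p ∈ Ω,
      deriv T p.1 * U p = A p.1 * p.2.2 + deriv A p.1 * p.2.1 + deriv B p.1 := by
    intro p hp
    rw [← hT1 p hp, H.pt_T_mul_U hp, hX1 p hp, hA p hp]; ring
  have hT0 : ∀ p ∈ Ω, deriv T p.1 ≠ 0 := fun p hp => by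
    rw [← hT1 p hp]; exact H.pt_T_ne_zero hp
  have hA0 : ∀ p ∈ Ω, A p.1 ≠ 0 := fun p hp => by
    rw [hA p hp]; exact (H.space_relation hp).2.1
  have hUd := fun p hp => pd_velocity_component hΩ hp hUform
    (sA.hasDerivAt_infty hJ (mJ p hp)).differentiableAt
    ((sA.deriv_infty hJ).hasDerivAt_infty hJ (mJ p hp)).differentiableAt
    ((sB.deriv_infty hJ).hasDerivAt_infty hJ (mJ p hp)).differentiableAt
    ((sT.deriv_infty hJ).hasDerivAt_infty hJ (mJ p hp)).differentiableAt
    (H.smooth_U.differentiableAt_infty hΩ hp)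
  have hU2 : ∀ p ∈ Ω, deriv T p.1 * ∂ₓ U p = deriv A p.1 := by
    intro p hp
    have := hUd p hp (0, 1, 0)
    simpa using this
  have hU22 : ∀ p ∈ Ω, ∂ₓ (∂ₓ U) p = 0 := by
    intro p hp
    have dT' := ((sT.deriv_infty hJ).hasDerivAt_infty hJ (mJ p hp)).differentiableAt
    have dA' := ((sA.deriv_infty hJ).hasDerivAt_infty hJ (mJ p hp)).differentiableAt
    have key := pd_congr hΩ (Φ := fun z => deriv T z.1 * ∂ₓ U z)
      (Ψ := fun z => deriv A z.1) hU2 hp (0, 1, 0)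
    rw [pd_mul (Φ := fun z => deriv T z.1) (dT'.comp p differentiableAt_fst)
      ((contDiffOn_pd H.smooth_U hΩ (0, 1, 0)).differentiableAt_infty hΩ hp), pd_comp_fst dT',
      pd_comp_fst dA'] at key
    have : deriv T p.1 * ∂ₓ (∂ₓ U) p = 0 := by linear_combination key
    exact (mul_eq_zero.1 this).resolve_left (hT0 p hp)
  -- the part of the determining relation that is free of derivatives is affine in `(x, u)`
  obtain ⟨k, hk⟩ : ∃ k : ℝ → ℝ,
      k = fun t => L'.h (T t) * deriv T t - deriv (deriv T) t / deriv T t := ⟨_, rfl⟩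
  have hcoef : ∀ p ∈ Ω, (2 * deriv A p.1 - L.h p.1 * A p.1 + k p.1 * A p.1) * p.2.2
      + (deriv (deriv A) p.1 + k p.1 * deriv A p.1) * p.2.1
      + (deriv (deriv B) p.1 + k p.1 * deriv B p.1) = 0 := by
    rw [hk]
    intro p hp
    obtain ⟨-, -, -, h4⟩ := H.velocity_relations hp
    have e1 := hUd p hp (1, 0, 0)
    have e2 := hU2 p hp
    have e3 := H.pt_T_mul_pu_U hp
    have e4 := hUform p hp
    rw [hU22 p hp, ← hA p hp, hT1 p hp, hX1 p hp, ← hT p hp] at h4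
    rw [← hA p hp, hT1 p hp] at e3
    have a0 := hA0 p hp
    have t0 := hT0 p hp
    simp only [one_mul, mul_zero, add_zero] at e1
    have e1' : ∂ₜ U p = (deriv A p.1 * p.2.2 + deriv (deriv A) p.1 * p.2.1 + deriv (deriv B) p.1
        - deriv (deriv T) p.1 * U p) / deriv T p.1 := by
      rw [eq_div_iff t0]; linear_combination e1
    have e2' : ∂ₓ U p = deriv A p.1 / deriv T p.1 := by
      rw [eq_div_iff t0]; linear_combination e2
    have e3' : ∂ᵤ U p = A p.1 / deriv T p.1 := by
      rw [eq_div_iff t0]; linear_combination e3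
    have e4' : U p = (A p.1 * p.2.2 + deriv A p.1 * p.2.1 + deriv B p.1) / deriv T p.1 := by
      rw [eq_div_iff t0]; linear_combination e4
    rw [e1', e2', e3', e4'] at h4
    field_simp at h4 ⊢
    refine mul_left_cancel₀ (pow_ne_zero 2 a0) ?_
    linear_combination h4
  have hzero : ∀ p ∈ Ω, k p.1 = L.h p.1 - 2 * (deriv A p.1 / A p.1) ∧
      deriv (deriv A) p.1 + k p.1 * deriv A p.1 = 0 ∧
      deriv (deriv B) p.1 + k p.1 * deriv B p.1 = 0 := by
    intro p hp
    obtain ⟨h1, h2, h3⟩ := eq_zero_of_affine_eqOn hΩ hp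
      (α := 2 * deriv A p.1 - L.h p.1 * A p.1 + k p.1 * A p.1)
      (β := deriv (deriv A) p.1 + k p.1 * deriv A p.1)
      (κ := deriv (deriv B) p.1 + k p.1 * deriv B p.1)
      (fun x u hxu => hcoef (p.1, x, u) hxu)
    refine ⟨mul_right_cancel₀ (hA0 p hp) ?_, h2, h3⟩
    have : 2 * (deriv A p.1 / A p.1) * A p.1 = 2 * deriv A p.1 := by
      have := hA0 p hp
      field_simp
    linear_combination h1 + this
  refine ⟨T, A, B, ⟨sT, sA, sB, ?_, ?_, ?_, ?_, ?_, ?_⟩, ?_⟩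
  · rintro _ ⟨p, hp, rfl⟩; exact hT0 p hp
  · rintro _ ⟨p, hp, rfl⟩; exact hA0 p hp
  · rintro _ ⟨p, hp, rfl⟩
    obtain ⟨h1, h2, h3⟩ := hzero p hp
    rw [h1] at h2
    linear_combination h2
  · rintro _ ⟨p, hp, rfl⟩
    obtain ⟨h1, h2, h3⟩ := hzero p hp
    rw [h1] at h3
    linear_combination h3
  · rintro _ ⟨p, hp, rfl⟩
    obtain ⟨h1, h2, h3⟩ := hzero p hp
    rw [hk] at h1
    rw [eq_div_iff (hT0 p hp)]
    linear_combination h1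
  · rintro _ ⟨p, hp, rfl⟩
    have := (H.space_relation hp).2.2
    rw [hT1 p hp, ← hA p hp, ← hT p hp] at this
    have t0 := hT0 p hp
    field_simp
    linear_combination -this
  · intro p hp
    have t0 := hT0 p hp
    rw [hFc]
    simp only [affineMap, hT p hp, Prod.mk.injEq, true_and]
    refine ⟨hXform p hp, ?_⟩
    rw [eq_div_iff t0]
    linear_combination hUform p hp

theorem deriv_comp_affine (ψ : ℝ → ℝ) (a b : ℝ) :
    deriv (fun y => ψ (a * y + b)) = fun y => a * deriv ψ (a * y + b) := by
  ext y
  have := deriv_comp_mul_left a (fun z => ψ (z + b)) y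
  rw [this, deriv_comp_add_const, smul_eq_mul]

/-- Transformations of the normal form are admissible. -/
theorem IsNormalForm.isAdmissible {L L' : BurgersEq} {F : ℝ × ℝ × ℝ → ℝ × ℝ × ℝ}
    {Ω : Set (ℝ × ℝ × ℝ)} {T A B : ℝ → ℝ} (hΩ : IsOpen Ω) (hs : Ω ⊆ L.strip)
    (ht : Set.MapsTo F Ω L'.strip) (H : IsNormalForm L L' T A B (Prod.fst '' Ω))
    (hF : Set.EqOn F (affineMap T A B) Ω) : IsAdmissible L L' F Ω := by
  have hJ := isOpen_image_fst hΩ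
  have mJ : Set.MapsTo Prod.fst Ω (Prod.fst '' Ω) := fun p hp => ⟨p, hp, rfl⟩
  have sT' := H.smooth_T.deriv_infty hJ
  have sA' := H.smooth_A.deriv_infty hJ
  have sB' := H.smooth_B.deriv_infty hJ
  have comp : ∀ {φ : ℝ → ℝ}, ContDiffOn ℝ ∞ φ (Prod.fst '' Ω) →
      ContDiffOn ℝ ∞ (fun p : ℝ × ℝ × ℝ => φ p.1) Ω :=
    fun hφ => hφ.comp contDiffOn_fst mJ
  have sx : ContDiffOn ℝ ∞ (fun p : ℝ × ℝ × ℝ => p.2.1) Ω := by fun_prop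
  have su : ContDiffOn ℝ ∞ (fun p : ℝ × ℝ × ℝ => p.2.2) Ω := by fun_prop
  have sF : ContDiffOn ℝ ∞ F Ω := by
    refine ContDiffOn.congr ?_ hF
    refine (comp H.smooth_T).prodMk ((((comp H.smooth_A).mul sx).add (comp H.smooth_B)).prodMk ?_)
    exact ((((comp H.smooth_A).mul su).add ((comp sA').mul sx)).add (comp sB')).div (comp sT')
      fun p hp => H.deriv_T_ne_zero _ (mJ hp)
  have hFT : ∀ p ∈ Ω, (F p).1 = T p.1 := fun p hp => by rw [hF hp]; rfl
  have hFX : ∀ p ∈ Ω, (F p).2.1 = A p.1 * p.2.1 + B p.1 := fun p hp => by rw [hF hp]; rfl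
  have hFU : ∀ p ∈ Ω, deriv T p.1 * (F p).2.2
      = A p.1 * p.2.2 + deriv A p.1 * p.2.1 + deriv B p.1 := fun p hp => by
    rw [hF hp]; exact mul_div_cancel₀ _ (H.deriv_T_ne_zero _ (mJ hp))
  refine ⟨hs, ht, ⟨sF, fun p hp => ?_⟩, ?_⟩
  · have dT := (H.smooth_T.hasDerivAt_infty hJ (mJ hp)).differentiableAt
    have dA := (H.smooth_A.hasDerivAt_infty hJ (mJ hp)).differentiableAt
    have dB := (H.smooth_B.hasDerivAt_infty hJ (mJ hp)).differentiableAt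
    have t0 := H.deriv_T_ne_zero _ (mJ hp)
    have a0 := H.A_ne_zero _ (mJ hp)
    refine det_ne_zero_of_ker _ fun v hv => ?_
    have dF := (sF.contDiffAt (hΩ.mem_nhds hp)).differentiableAt (by simp)
    rw [fderiv_apply_components dF, Prod.mk_eq_zero, Prod.mk_eq_zero] at hv
    obtain ⟨e1, e2, e3⟩ := hv
    rw [pd_congr hΩ (Ψ := fun z => T z.1) hFT hp, pd_comp_fst dT] at e1
    have v1 : v.1 = 0 := (mul_eq_zero.1 e1).resolve_right t0
    rw [pd_space_component hΩ hp hFX dA dB, v1] at e2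
    have v2 : v.2.1 = 0 := by
      have : A p.1 * v.2.1 = 0 := by linear_combination e2
      exact (mul_eq_zero.1 this).resolve_left a0
    have e4 := pd_velocity_component hΩ hp hFU dA (sA'.hasDerivAt_infty hJ (mJ hp)).differentiableAt
      (sB'.hasDerivAt_infty hJ (mJ hp)).differentiableAt
      (sT'.hasDerivAt_infty hJ (mJ hp)).differentiableAt (dF.snd.snd) v
    rw [e3, v1, v2] at e4
    have v3 : v.2.2 = 0 := by
      have : A p.1 * v.2.2 = 0 := by linear_combination -e4
      exact (mul_eq_zero.1 this).resolve_left a0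
    exact Prod.ext v1 (Prod.ext v2 v3)
  · intro f f' t x hp hI hL
    obtain ⟨hf, hf', -, hev⟩ := hI
    have htJ : t ∈ Prod.fst '' Ω := mJ hp
    have hb : baseMap F f (t, x) = (T t, A t * x + B t) := by
      unfold baseMap
      rw [hF hp]; rfl
    rw [hb] at hf' ⊢
    have hev' : ∀ᶠ r : ℝ × ℝ in 𝓝 (t, x), f' (T r.1) (A r.1 * r.2 + B r.1)
        = (A r.1 * f r.1 r.2 + deriv A r.1 * r.2 + deriv B r.1) / deriv T r.1 := by
      have hcont : ContinuousAt (fun r : ℝ × ℝ => (r.1, r.2, f r.1 r.2)) (t, x) :=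
        continuousAt_fst.prodMk (continuousAt_snd.prodMk hf.continuousAt)
      filter_upwards [hev, hcont.eventually (hΩ.mem_nhds hp)] with r hr hrΩ
      have hb : baseMap F f r = (T r.1, A r.1 * r.2 + B r.1) := by
        unfold baseMap
        rw [hF hrΩ]; rfl
      rw [hb, hF hrΩ] at hr
      exact hr
    have t0 := H.deriv_T_ne_zero _ htJ
    have a0 := H.A_ne_zero _ htJ
    have hT1 := H.smooth_T.hasDerivAt_infty hJ htJ
    have hA1 := H.smooth_A.hasDerivAt_infty hJ htJ
    have hB1 := H.smooth_B.hasDerivAt_infty hJ htJ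
    have hT2 := sT'.hasDerivAt_infty hJ htJ
    have hA2 := sA'.hasDerivAt_infty hJ htJ
    have hB2 := sB'.hasDerivAt_infty hJ htJ
    have hft : ContDiffAt ℝ ∞ (fun s => f s x) t :=
      ContDiffAt.comp t (f := fun s : ℝ => (s, x)) (g := fun r : ℝ × ℝ => f r.1 r.2) hf
        (by fun_prop)
    have hfx : ContDiffAt ℝ ∞ (fun y => f t y) x :=
      ContDiffAt.comp x (f := fun s : ℝ => (t, s)) (g := fun r : ℝ × ℝ => f r.1 r.2) hf
        (by fun_prop)
    have hft1 := hft.eventually_hasDerivAt.self_of_nhds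
    -- derivatives along the line through `(t, x)` in the direction of `x`
    have hevx : (fun y => f' (T t) (A t * y + B t)) =ᶠ[𝓝 x]
        fun y => (A t * f t y + deriv A t * y + deriv B t) / deriv T t :=
      (Continuous.continuousAt (f := fun y : ℝ => (t, y)) (by fun_prop)).eventually hev'
    have hdx : ∀ᶠ y in 𝓝 x,
        deriv (fun y => (A t * f t y + deriv A t * y + deriv B t) / deriv T t) y
          = (A t * deriv (fun y => f t y) y + deriv A t) / deriv T t := by
      filter_upwards [hfx.eventually_hasDerivAt] with y hy
      have := ((((hy.const_mul (A t)).add ((hasDerivAt_id y).const_mul (deriv A t))).add_const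
        (deriv B t)).div_const (deriv T t)).deriv
      simpa using this
    have hx1 : A t * deriv (fun y => f' (T t) y) (A t * x + B t)
        = (A t * deriv (fun y => f t y) x + deriv A t) / deriv T t := by
      rw [← hdx.self_of_nhds, ← hevx.deriv_eq, deriv_comp_affine (fun y => f' (T t) y)]
    have hx2 : A t ^ 2 * deriv (deriv fun y => f' (T t) y) (A t * x + B t)
        = A t * deriv (deriv fun y => f t y) x / deriv T t := by
      have h1 : deriv (deriv fun y => (A t * f t y + deriv A t * y + deriv B t) / deriv T t) x
          = A t * deriv (deriv fun y => f t y) x / deriv T t := by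
        rw [Filter.EventuallyEq.deriv_eq hdx]
        have := (((hfx.deriv_infty.eventually_hasDerivAt.self_of_nhds.const_mul (A t)).add_const
          (deriv A t)).div_const (deriv T t)).deriv
        exact this
      rw [← h1, ← hevx.deriv.deriv_eq, deriv_comp_affine (fun y => f' (T t) y)]
      rw [deriv_comp_affine (fun z => A t * deriv (fun y => f' (T t) y) z)]
      simp only [deriv_const_mul_field]
      ring
    -- the derivative along the line in the direction of `t`
    have hevt : (fun s => f' (T s) (A s * x + B s)) =ᶠ[𝓝 t]
        fun s => (A s * f s x + deriv A s * x + deriv B s) / deriv T s :=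
      (Continuous.continuousAt (f := fun s : ℝ => (s, x)) (by fun_prop)).eventually hev'
    obtain ⟨φ, hφ⟩ : ∃ φ : ℝ × ℝ → ℝ, φ = fun r => f' r.1 r.2 := ⟨_, rfl⟩
    rw [← hφ] at hf'
    have hφd := (hf'.differentiableAt (by simp)).hasFDerivAt
    have hφ1 : deriv (fun s => f' s (A t * x + B t)) (T t)
        = fderiv ℝ φ (T t, A t * x + B t) (1, 0) := by
      have := (HasFDerivAt.comp_hasDerivAt (f := fun s : ℝ => (s, A t * x + B t)) (T t) hφd
        ((hasDerivAt_id _).prodMk (hasDerivAt_const _ _))).deriv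
      rw [← this, hφ]; rfl
    have hφ2 : deriv (fun y => f' (T t) y) (A t * x + B t)
        = fderiv ℝ φ (T t, A t * x + B t) (0, 1) := by
      have := (HasFDerivAt.comp_hasDerivAt (f := fun s : ℝ => (T t, s)) (A t * x + B t) hφd
        ((hasDerivAt_const _ _).prodMk (hasDerivAt_id _))).deriv
      rw [← this, hφ]; rfl
    have ht1 : deriv T t * deriv (fun s => f' s (A t * x + B t)) (T t)
        + (deriv A t * x + deriv B t) * deriv (fun y => f' (T t) y) (A t * x + B t)
        = ((deriv A t * f t x + A t * deriv (fun s => f s x) t + deriv (deriv A) t * x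
            + deriv (deriv B) t) * deriv T t
          - (A t * f t x + deriv A t * x + deriv B t) * deriv (deriv T) t) / deriv T t ^ 2 := by
      have h1 := HasFDerivAt.comp_hasDerivAt (f := fun s : ℝ => (T s, A s * x + B s)) t hφd
        (hT1.prodMk ((hA1.mul_const x).add hB1))
      have h2 : HasDerivAt (fun s => (A s * f s x + deriv A s * x + deriv B s) / deriv T s) _ t :=
        (((hA1.mul hft1).add (hA2.mul_const x)).add hB2).div hT2 t0
      have e : (φ ∘ fun s => (T s, A s * x + B s)) = fun s => f' (T s) (A s * x + B s) := by
        rw [hφ]; rfl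
      have h3 := h1.unique (by rw [e]; exact h2.congr_of_eventuallyEq hevt)
      rw [hφ1, hφ2, ← clm_apply_pair, h3]
      simp
    have hval := hevt.self_of_nhds
    simp only at hval
    unfold BurgersEq.HoldsAt at hL ⊢
    simp only
    rw [hval, H.h_rule t htJ, H.g_rule t htJ]
    rw [H.ode_A t htJ, H.ode_B t htJ] at ht1
    generalize deriv (fun s => f' s (A t * x + B t)) (T t) = P1 at *
    generalize deriv (fun y => f' (T t) y) (A t * x + B t) = P2 at *
    generalize deriv (deriv fun y => f' (T t) y) (A t * x + B t) = P22 at *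
    generalize deriv (fun s => f s x) t = Q1 at *
    generalize deriv (fun y => f t y) x = Q2 at *
    generalize deriv (deriv fun y => f t y) x = Q22 at *
    have e2 : P2 = (A t * Q2 + deriv A t) / deriv T t / A t := by
      rw [eq_div_iff a0]; linear_combination hx1
    have e22 : P22 = A t * Q22 / deriv T t / A t ^ 2 := by
      rw [eq_div_iff (pow_ne_zero 2 a0)]; linear_combination hx2
    have eQ : Q1 = L.g t * Q22 - f t x * Q2 - L.h t * f t x := by linear_combination hL
    rw [e2, eQ] at ht1
    have e1 : P1 = _ := eq_div_of_mul_eq t0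
      ((mul_comm _ _).trans (eq_sub_of_add_eq ht1))
    rw [e1, e2, e22]
    field_simp
    ring

/-! ### Composition and inversion of normal forms -/

theorem deriv_and_deriv_deriv {J : Set ℝ} (hJ : IsOpen J) {f f₁ f₂ : ℝ → ℝ}
    (h1 : ∀ t ∈ J, HasDerivAt f (f₁ t) t) (h2 : ∀ t ∈ J, HasDerivAt f₁ (f₂ t) t) {t : ℝ}
    (ht : t ∈ J) : deriv f t = f₁ t ∧ deriv (deriv f) t = f₂ t := by
  refine ⟨(h1 t ht).deriv, ?_⟩
  have : deriv f =ᶠ[𝓝 t] f₁ := by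
    filter_upwards [hJ.mem_nhds ht] with s hs using (h1 s hs).deriv
  rw [this.deriv_eq, (h2 t ht).deriv]

theorem deriv_congr_of_eqOn {J : Set ℝ} (hJ : IsOpen J) {f g : ℝ → ℝ} (h : Set.EqOn f g J) :
    Set.EqOn (deriv f) (deriv g) J := fun _ ht =>
  (h.eventuallyEq_of_mem (hJ.mem_nhds ht)).deriv_eq

theorem affineMap_congr {J : Set ℝ} (hJ : IsOpen J) {T A B A' B' : ℝ → ℝ} (hA : Set.EqOn A A' J)
    (hB : Set.EqOn B B' J) {p : ℝ × ℝ × ℝ} (hp : p.1 ∈ J) :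
    affineMap T A B p = affineMap T A' B' p := by
  simp only [affineMap, hA hp, hB hp, deriv_congr_of_eqOn hJ hA hp, deriv_congr_of_eqOn hJ hB hp]

theorem IsNormalForm.mono {L L' : BurgersEq} {T A B : ℝ → ℝ} {J J₁ : Set ℝ}
    (H : IsNormalForm L L' T A B J) (h : J₁ ⊆ J) : IsNormalForm L L' T A B J₁ where
  smooth_T := H.smooth_T.mono h
  smooth_A := H.smooth_A.mono h
  smooth_B := H.smooth_B.mono h
  deriv_T_ne_zero t ht := H.deriv_T_ne_zero t (h ht)
  A_ne_zero t ht := H.A_ne_zero t (h ht)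
  ode_A t ht := H.ode_A t (h ht)
  ode_B t ht := H.ode_B t (h ht)
  h_rule t ht := H.h_rule t (h ht)
  g_rule t ht := H.g_rule t (h ht)

theorem IsNormalForm.refl (L : BurgersEq) (J : Set ℝ) :
    IsNormalForm L L id (fun _ => 1) (fun _ => 0) J where
  smooth_T := contDiffOn_id
  smooth_A := contDiffOn_const
  smooth_B := contDiffOn_const
  deriv_T_ne_zero t _ := by simp
  A_ne_zero t _ := one_ne_zero
  ode_A t _ := by simp
  ode_B t _ := by simp
  h_rule t _ := by simp [deriv_id']
  g_rule t _ := by simp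

theorem affineMap_refl (p : ℝ × ℝ × ℝ) : affineMap id (fun _ => 1) (fun _ => 0) p = p := by
  simp [affineMap]

section Comp

variable {L L' L'' : BurgersEq} {T A B T' A' B' : ℝ → ℝ} {J J' : Set ℝ}

/-- The composition of normal forms is the normal form of the composed transformation. -/
theorem IsNormalForm.comp (hJ : IsOpen J) (hJ' : IsOpen J') (H' : IsNormalForm L' L'' T' A' B' J')
    (H : IsNormalForm L L' T A B J) (hT : Set.MapsTo T J J') :
    IsNormalForm L L'' (fun t => T' (T t)) (fun t => A' (T t) * A t)
        (fun t => A' (T t) * B t + B' (T t)) J ∧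
      ∀ p : ℝ × ℝ × ℝ, p.1 ∈ J → affineMap T' A' B' (affineMap T A B p) =
        affineMap (fun t => T' (T t)) (fun t => A' (T t) * A t)
          (fun t => A' (T t) * B t + B' (T t)) p := by
  have t1 := fun t ht => H.smooth_T.hasDerivAt_infty hJ (t := t) ht
  have a1 := fun t ht => H.smooth_A.hasDerivAt_infty hJ (t := t) ht
  have b1 := fun t ht => H.smooth_B.hasDerivAt_infty hJ (t := t) ht
  have t2 := fun t ht => (H.smooth_T.deriv_infty hJ).hasDerivAt_infty hJ (t := t) ht
  have a2 := fun t ht => (H.smooth_A.deriv_infty hJ).hasDerivAt_infty hJ (t := t) ht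
  have b2 := fun t ht => (H.smooth_B.deriv_infty hJ).hasDerivAt_infty hJ (t := t) ht
  have t1' := fun t (ht : t ∈ J) =>
    (H'.smooth_T.hasDerivAt_infty hJ' (hT ht)).comp t (t1 t ht)
  have a1' := fun t (ht : t ∈ J) =>
    (H'.smooth_A.hasDerivAt_infty hJ' (hT ht)).comp t (t1 t ht)
  have b1' := fun t (ht : t ∈ J) =>
    (H'.smooth_B.hasDerivAt_infty hJ' (hT ht)).comp t (t1 t ht)
  have t2' := fun t (ht : t ∈ J) =>
    ((H'.smooth_T.deriv_infty hJ').hasDerivAt_infty hJ' (hT ht)).comp t (t1 t ht)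
  have a2' := fun t (ht : t ∈ J) =>
    ((H'.smooth_A.deriv_infty hJ').hasDerivAt_infty hJ' (hT ht)).comp t (t1 t ht)
  have b2' := fun t (ht : t ∈ J) =>
    ((H'.smooth_B.deriv_infty hJ').hasDerivAt_infty hJ' (hT ht)).comp t (t1 t ht)
  have dT := fun t ht => deriv_and_deriv_deriv hJ (t := t) (f := fun t => T' (T t)) t1'
    (fun t ht => (t2' t ht).mul (t2 t ht)) ht
  have dA := fun t ht => deriv_and_deriv_deriv hJ (t := t) (f := fun t => A' (T t) * A t)
    (fun t ht => (a1' t ht).mul (a1 t ht))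
    (fun t ht => (((a2' t ht).mul (t2 t ht)).mul (a1 t ht)).add
      ((a1' t ht).mul (a2 t ht))) ht
  have dB := fun t ht => deriv_and_deriv_deriv hJ (t := t)
    (f := fun t => A' (T t) * B t + B' (T t))
    (fun t ht => ((a1' t ht).mul (b1 t ht)).add (b1' t ht))
    (fun t ht => ((((a2' t ht).mul (t2 t ht)).mul (b1 t ht)).add
      ((a1' t ht).mul (b2 t ht))).add ((b2' t ht).mul (t2 t ht))) ht
  simp only [Function.comp_apply, Pi.mul_apply] at dT dA dB
  refine ⟨⟨H'.smooth_T.comp H.smooth_T hT, (H'.smooth_A.comp H.smooth_T hT).mul H.smooth_A,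
    ((H'.smooth_A.comp H.smooth_T hT).mul H.smooth_B).add (H'.smooth_B.comp H.smooth_T hT),
    ?_, ?_, ?_, ?_, ?_, ?_⟩, ?_⟩
  · intro t ht
    rw [(dT t ht).1]
    exact mul_ne_zero (H'.deriv_T_ne_zero _ (hT ht)) (H.deriv_T_ne_zero _ ht)
  · intro t ht
    exact mul_ne_zero (H'.A_ne_zero _ (hT ht)) (H.A_ne_zero _ ht)
  · intro t ht
    have n1 := H.A_ne_zero _ ht
    have n2 := H'.A_ne_zero _ (hT ht)
    have n3 := H.deriv_T_ne_zero _ ht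
    have n4 := H'.deriv_T_ne_zero _ (hT ht)
    simp only [(dA t ht).1, (dA t ht).2, H'.ode_A _ (hT ht), H.ode_A _ ht, H.h_rule _ ht]
    field_simp
    ring
  · intro t ht
    have n1 := H.A_ne_zero _ ht
    have n2 := H'.A_ne_zero _ (hT ht)
    have n3 := H.deriv_T_ne_zero _ ht
    have n4 := H'.deriv_T_ne_zero _ (hT ht)
    simp only [(dA t ht).1, (dB t ht).1, (dB t ht).2, H'.ode_A _ (hT ht), H'.ode_B _ (hT ht),
      H.ode_B _ ht, H.h_rule _ ht]
    field_simp
    ring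
  · intro t ht
    have n1 := H.A_ne_zero _ ht
    have n2 := H'.A_ne_zero _ (hT ht)
    have n3 := H.deriv_T_ne_zero _ ht
    have n4 := H'.deriv_T_ne_zero _ (hT ht)
    simp only [(dA t ht).1, (dT t ht).1, (dT t ht).2, H'.h_rule _ (hT ht), H.h_rule _ ht]
    field_simp
    ring
  · intro t ht
    have n3 := H.deriv_T_ne_zero _ ht
    have n4 := H'.deriv_T_ne_zero _ (hT ht)
    simp only [(dT t ht).1, H'.g_rule _ (hT ht), H.g_rule _ ht]
    field_simp
  · intro p hp
    have n3 := H.deriv_T_ne_zero _ hp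
    have n4 := H'.deriv_T_ne_zero _ (hT hp)
    simp only [affineMap, (dT _ hp).1, (dA _ hp).1, (dB _ hp).1, Prod.mk.injEq, true_and]
    constructor
    · ring
    · field_simp
      ring

end Comp

section Inverse

variable {T : ℝ → ℝ} {J : Set ℝ}

theorem injOn_of_deriv_ne_zero (hc : J.OrdConnected) (hT : ContDiffOn ℝ ∞ T J)
    (h0 : ∀ t ∈ J, deriv T t ≠ 0) : Set.InjOn T J := by
  have key : ∀ a ∈ J, ∀ b ∈ J, a < b → T a ≠ T b := by
    intro a ha b hb hab he
    obtain ⟨c, hc', hd⟩ := exists_deriv_eq_zero hab (hT.continuousOn.mono (hc.out ha hb)) he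
    exact h0 c (hc.out ha hb (Set.Ioo_subset_Icc_self hc')) hd
  intro a ha b hb he
  by_contra hne
  rcases lt_or_gt_of_ne hne with h | h
  · exact key a ha b hb h he
  · exact key b hb a ha h he.symm

theorem map_nhds_of_deriv_ne_zero (hJ : IsOpen J) (hT : ContDiffOn ℝ ∞ T J)
    (h0 : ∀ t ∈ J, deriv T t ≠ 0) {t : ℝ} (ht : t ∈ J) :
    Filter.map T (𝓝 t) = 𝓝 (T t) :=
  HasStrictDerivAt.map_nhds_eq
    ((hT.contDiffAt (hJ.mem_nhds ht)).hasStrictDerivAt' (hT.hasDerivAt_infty hJ ht) (by simp))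
    (h0 t ht)

theorem isOpen_image_of_deriv_ne_zero (hJ : IsOpen J) (hT : ContDiffOn ℝ ∞ T J)
    (h0 : ∀ t ∈ J, deriv T t ≠ 0) : IsOpen (T '' J) := by
  rw [isOpen_iff_mem_nhds]
  rintro _ ⟨t, ht, rfl⟩
  rw [← map_nhds_of_deriv_ne_zero hJ hT h0 ht]
  exact Filter.image_mem_map (hJ.mem_nhds ht)

/-- A smooth function with nonvanishing derivative on an open interval has a smooth inverse. -/
theorem exists_smooth_inverse (hJ : IsOpen J) (hc : J.OrdConnected) (hT : ContDiffOn ℝ ∞ T J)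
    (h0 : ∀ t ∈ J, deriv T t ≠ 0) :
    ∃ S : ℝ → ℝ, (∀ t ∈ J, S (T t) = t) ∧ ContDiffOn ℝ ∞ S (T '' J) ∧
      ∀ s ∈ T '' J, HasDerivAt S (deriv T (S s))⁻¹ s := by
  have hinj := injOn_of_deriv_ne_zero hc hT h0
  have hleft : ∀ t ∈ J, Function.invFunOn T J (T t) = t := fun t ht =>
    hinj.leftInvOn_invFunOn ht
  have hsm : ∀ t ∈ J, ContDiffAt ℝ ∞ (Function.invFunOn T J) (T t) := by
    intro t ht
    have hTt := hT.contDiffAt (hJ.mem_nhds ht)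
    have hdet : (fderiv ℝ T t).det ≠ 0 := by
      refine det_ne_zero_of_ker _ fun v hv => ?_
      rw [(hT.hasDerivAt_infty hJ ht).hasFDerivAt.fderiv] at hv
      simpa [h0 t ht] using hv
    obtain ⟨R, hR, -, hRT⟩ := exists_local_inverse hTt hdet
    refine hR.congr_of_eventuallyEq ?_
    rw [Filter.EventuallyEq, ← map_nhds_of_deriv_ne_zero hJ hT h0 ht, Filter.eventually_map]
    filter_upwards [hRT, hJ.mem_nhds ht] with s hs hsJ
    rw [hs, hleft s hsJ]
  refine ⟨Function.invFunOn T J, hleft, ?_, ?_⟩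
  · rintro _ ⟨t, ht, rfl⟩
    exact (hsm t ht).contDiffWithinAt
  · rintro _ ⟨t, ht, rfl⟩
    have hd := ((hsm t ht).differentiableAt (by simp)).hasDerivAt
    have h1 := hd.comp t (hT.hasDerivAt_infty hJ ht)
    have h2 : HasDerivAt (Function.invFunOn T J ∘ T) 1 t := by
      refine (hasDerivAt_id t).congr_of_eventuallyEq ?_
      filter_upwards [hJ.mem_nhds ht] with s hs
      exact hleft s hs
    have h3 := h1.unique h2
    rw [hleft t ht]
    rw [eq_inv_of_mul_eq_one_left h3] at hd
    exact hd

variable {L L' : BurgersEq} {A B : ℝ → ℝ}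

/-- The inverse of a transformation of the normal form is of the normal form. -/
theorem IsNormalForm.exists_inverse (hJ : IsOpen J) (hc : J.OrdConnected)
    (H : IsNormalForm L L' T A B J) :
    ∃ S C D : ℝ → ℝ, IsNormalForm L' L S C D (T '' J) ∧ (∀ t ∈ J, S (T t) = t) ∧
      (∀ p : ℝ × ℝ × ℝ, p.1 ∈ J → affineMap S C D (affineMap T A B p) = p) ∧
      ∀ p : ℝ × ℝ × ℝ, p.1 ∈ T '' J → affineMap T A B (affineMap S C D p) = p := by
  have hJ' := isOpen_image_of_deriv_ne_zero hJ H.smooth_T H.deriv_T_ne_zero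
  obtain ⟨S, hS, sS, s1⟩ := exists_smooth_inverse hJ hc H.smooth_T H.deriv_T_ne_zero
  have hmem : ∀ s ∈ T '' J, S s ∈ J ∧ T (S s) = s := by
    rintro _ ⟨t, ht, rfl⟩
    rw [hS t ht]; exact ⟨ht, rfl⟩
  have hmaps : Set.MapsTo S (T '' J) J := fun s hs => (hmem s hs).1
  have t0 := fun s hs => H.deriv_T_ne_zero _ (hmem s hs).1
  have a0 := fun s hs => H.A_ne_zero _ (hmem s hs).1
  have t1 := fun s (hs : s ∈ T '' J) =>
    ((H.smooth_T.deriv_infty hJ).hasDerivAt_infty hJ (hmem s hs).1).comp s (s1 s hs)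
  have a1 := fun s (hs : s ∈ T '' J) =>
    (H.smooth_A.hasDerivAt_infty hJ (hmem s hs).1).comp s (s1 s hs)
  have a2 := fun s (hs : s ∈ T '' J) =>
    ((H.smooth_A.deriv_infty hJ).hasDerivAt_infty hJ (hmem s hs).1).comp s (s1 s hs)
  have b1 := fun s (hs : s ∈ T '' J) =>
    (H.smooth_B.hasDerivAt_infty hJ (hmem s hs).1).comp s (s1 s hs)
  have b2 := fun s (hs : s ∈ T '' J) =>
    ((H.smooth_B.deriv_infty hJ).hasDerivAt_infty hJ (hmem s hs).1).comp s (s1 s hs)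
  have dS := fun s hs => deriv_and_deriv_deriv hJ' (t := s) s1
    (fun s hs => (t1 s hs).inv (t0 s hs)) hs
  have dC := fun s hs => deriv_and_deriv_deriv hJ' (t := s) (f := fun s => (A (S s))⁻¹)
    (f₁ := fun s => -(deriv A (S s) * (deriv T (S s))⁻¹) / A (S s) ^ 2)
    (fun s hs => (a1 s hs).inv (a0 s hs))
    (fun s hs => (((a2 s hs).mul ((t1 s hs).inv (t0 s hs))).neg).div ((a1 s hs).pow 2)
      (pow_ne_zero 2 (a0 s hs))) hs
  have dD := fun s hs => deriv_and_deriv_deriv hJ' (t := s) (f := fun s => -(B (S s) / A (S s)))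
    (f₁ := fun s => -((deriv B (S s) * (deriv T (S s))⁻¹ * A (S s)
      - B (S s) * (deriv A (S s) * (deriv T (S s))⁻¹)) / A (S s) ^ 2))
    (fun s hs => ((b1 s hs).div (a1 s hs) (a0 s hs)).neg)
    (fun s hs => ((((b2 s hs).mul ((t1 s hs).inv (t0 s hs))).mul (a1 s hs)).sub
      ((b1 s hs).mul ((a2 s hs).mul ((t1 s hs).inv (t0 s hs))))).div ((a1 s hs).pow 2)
      (pow_ne_zero 2 (a0 s hs)) |>.neg) hs
  simp only [Function.comp_apply, Pi.mul_apply, Pi.inv_apply, Pi.sub_apply, Pi.neg_apply,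
    Pi.pow_apply] at dS dC dD
  have sA := H.smooth_A.comp sS hmaps
  have sB := H.smooth_B.comp sS hmaps
  have hh : ∀ s ∈ T '' J, L'.h s = (L.h (S s) + deriv (deriv T) (S s) / deriv T (S s)
      - 2 * (deriv A (S s) / A (S s))) / deriv T (S s) := by
    intro s hs
    have := H.h_rule _ (hmem s hs).1
    rwa [(hmem s hs).2] at this
  have hg : ∀ s ∈ T '' J, L'.g s = A (S s) ^ 2 / deriv T (S s) * L.g (S s) := by
    intro s hs
    have := H.g_rule _ (hmem s hs).1
    rwa [(hmem s hs).2] at this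
  have N : IsNormalForm L' L S (fun s => (A (S s))⁻¹) (fun s => -(B (S s) / A (S s))) (T '' J) := by
    refine ⟨sS, sA.inv a0, (sB.div sA a0).neg, ?_, ?_, ?_, ?_, ?_, ?_⟩
    · intro s hs
      rw [(dS s hs).1]; exact inv_ne_zero (t0 s hs)
    · intro s hs
      exact inv_ne_zero (a0 s hs)
    · intro s hs
      have n1 := t0 s hs
      have n2 := a0 s hs
      simp only [(dC s hs).1, (dC s hs).2, hh s hs, H.ode_A _ (hmem s hs).1]
      field_simp
      ring
    · intro s hs
      have n1 := t0 s hs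
      have n2 := a0 s hs
      simp only [(dC s hs).1, (dD s hs).1, (dD s hs).2, hh s hs, H.ode_A _ (hmem s hs).1,
        H.ode_B _ (hmem s hs).1]
      field_simp
      ring
    · intro s hs
      have n1 := t0 s hs
      have n2 := a0 s hs
      simp only [(dC s hs).1, (dS s hs).1, (dS s hs).2, hh s hs]
      field_simp
      ring
    · intro s hs
      have n1 := t0 s hs
      have n2 := a0 s hs
      simp only [(dS s hs).1, hg s hs]
      field_simp
  refine ⟨S, _, _, N, hS, ?_, ?_⟩
  · intro p hp
    have hm : T p.1 ∈ T '' J := ⟨p.1, hp, rfl⟩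
    have n1 := H.deriv_T_ne_zero _ hp
    have n2 := H.A_ne_zero _ hp
    obtain ⟨t, x, u⟩ := p
    simp only [affineMap, (dS _ hm).1, (dC _ hm).1, (dD _ hm).1, hS _ hp, Prod.mk.injEq, true_and]
    constructor
    · field_simp; ring
    · field_simp; ring
  · intro p hp
    have n1 := t0 _ hp
    have n2 := a0 _ hp
    obtain ⟨t, x, u⟩ := p
    simp only [affineMap, (dS _ hp).1, (dC _ hp).1, (dD _ hp).1, (hmem _ hp).2, Prod.mk.injEq,
      true_and]
    constructor
    · field_simp; ring
    · field_simp; ring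

end Inverse

/-! ### Equations with prescribed coefficients -/

namespace BurgersEq

/-- The equation on the interval `J` with the coefficients `h` and `g`, whose values off `J` are
discarded. -/
noncomputable def ofOn (J : Set ℝ) (h g : ℝ → ℝ) (hJ : IsOpen J) (hc : J.OrdConnected)
    (hne : J.Nonempty) (sh : ContDiffOn ℝ ∞ h J) (sg : ContDiffOn ℝ ∞ g J)
    (g0 : ∀ t ∈ J, g t ≠ 0) : BurgersEq where
  I := J
  h := J.indicator h
  g := J.indicator g
  isOpen_I := hJ
  ordConnected_I := hc
  nonempty_I := hne
  smooth_h := sh.congr fun _ ht => Set.indicator_of_mem ht h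
  smooth_g := sg.congr fun _ ht => Set.indicator_of_mem ht g
  g_ne_zero t ht := by rw [Set.indicator_of_mem ht]; exact g0 t ht
  h_off _ ht := Set.indicator_of_notMem ht h
  g_off _ ht := Set.indicator_of_notMem ht g

theorem exists_restriction (L : BurgersEq) {J : Set ℝ} (hJ : IsOpen J) (hc : J.OrdConnected)
    (hne : J.Nonempty) (hs : J ⊆ L.I) : ∃ L₁ : BurgersEq, L₁.IsRestriction L ∧ L₁.I = J :=
  ⟨ofOn J L.h L.g hJ hc hne (L.smooth_h.mono hs) (L.smooth_g.mono hs)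
    fun t ht => L.g_ne_zero t (hs ht), ⟨hs, fun _ ht => Set.indicator_of_mem ht _,
    fun _ ht => Set.indicator_of_mem ht _⟩, rfl⟩

theorem convex_strip (L : BurgersEq) : Convex ℝ L.strip :=
  (convex_iff_ordConnected.2 L.ordConnected_I).linear_preimage (LinearMap.fst ℝ ℝ (ℝ × ℝ))

theorem isOpen_strip (L : BurgersEq) : IsOpen L.strip := L.isOpen_I.preimage continuous_fst

theorem image_fst_strip (L : BurgersEq) : Prod.fst '' L.strip = L.I := by
  ext t
  constructor
  · rintro ⟨p, hp, rfl⟩; exact hp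
  · intro ht; exact ⟨(t, 0, 0), ht, rfl⟩

end BurgersEq

theorem ordConnected_image {T : ℝ → ℝ} {J : Set ℝ} (hc : J.OrdConnected)
    (hT : ContinuousOn T J) : (T '' J).OrdConnected :=
  (hc.isPreconnected.image T hT).ordConnected

theorem IsNormalForm.restriction {L L' L₁ L₁' : BurgersEq} {T A B : ℝ → ℝ} {J : Set ℝ}
    (H : IsNormalForm L L' T A B J) (h1 : L₁.IsRestriction L) (h1' : L₁'.IsRestriction L')
    (hJ : J ⊆ L₁.I) (hJ' : Set.MapsTo T J L₁'.I) : IsNormalForm L₁ L₁' T A B J :=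
  { H with
    ode_A := fun t ht => by rw [h1.2.1 (hJ ht)]; exact H.ode_A t ht
    ode_B := fun t ht => by rw [h1.2.1 (hJ ht)]; exact H.ode_B t ht
    h_rule := fun t ht => by rw [h1.2.1 (hJ ht), h1'.2.1 (hJ' ht)]; exact H.h_rule t ht
    g_rule := fun t ht => by rw [h1.2.2 (hJ ht), h1'.2.2 (hJ' ht)]; exact H.g_rule t ht }

/-- The image of an equation of the class: its coefficients are determined by `T` and `A`. -/
theorem exists_image_equation (L : BurgersEq) {T A : ℝ → ℝ}
    (sT : ContDiffOn ℝ ∞ T L.I) (sA : ContDiffOn ℝ ∞ A L.I) (t0 : ∀ t ∈ L.I, deriv T t ≠ 0)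
    (a0 : ∀ t ∈ L.I, A t ≠ 0) :
    ∃ L' : BurgersEq, L'.I = T '' L.I ∧ ∀ t ∈ L.I,
      L'.h (T t) = (L.h t + deriv (deriv T) t / deriv T t - 2 * (deriv A t / A t)) / deriv T t ∧
      L'.g (T t) = A t ^ 2 / deriv T t * L.g t := by
  have hI := L.isOpen_I
  obtain ⟨S, hS, sS, -⟩ := exists_smooth_inverse hI L.ordConnected_I sT t0
  have hmaps : Set.MapsTo S (T '' L.I) L.I := by
    rintro _ ⟨t, ht, rfl⟩
    rw [hS t ht]; exact ht
  have sT' := sT.deriv_infty hI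
  have sA' := sA.deriv_infty hI
  have sh := ((((L.smooth_h.add ((sT'.deriv_infty hI).div sT' t0)).sub
    (contDiffOn_const.mul (sA'.div sA a0) : ContDiffOn ℝ ∞ (fun t => 2 * (deriv A t / A t)) L.I)).div
    sT' t0)).comp sS hmaps
  have sg := (((sA.pow 2).div sT' t0).mul L.smooth_g).comp sS hmaps
  refine ⟨BurgersEq.ofOn (T '' L.I) _ _ (isOpen_image_of_deriv_ne_zero hI sT t0)
    (ordConnected_image L.ordConnected_I sT.continuousOn) (L.nonempty_I.image T) sh sg ?_,
    rfl, ?_⟩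
  · intro s hs
    exact mul_ne_zero (div_ne_zero (pow_ne_zero 2 (a0 _ (hmaps hs))) (t0 _ (hmaps hs)))
      (L.g_ne_zero _ (hmaps hs))
  · intro t ht
    have hm : T t ∈ T '' L.I := ⟨t, ht, rfl⟩
    refine ⟨(Set.indicator_of_mem hm _).trans ?_, (Set.indicator_of_mem hm _).trans ?_⟩
    · simp only [Function.comp_apply, hS t ht]; rfl
    · simp only [Function.comp_apply, hS t ht]; rfl

/-! ### The parameters of a normal form -/

theorem BurgersEq.IsDampingIntegral.contDiffOn {L : BurgersEq} {θ : ℝ → ℝ}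
    (h : L.IsDampingIntegral θ) : ContDiffOn ℝ ∞ θ L.I := by
  obtain ⟨H, hH, hθ⟩ := h
  have sH : ContDiffOn ℝ ∞ H L.I := by
    rw [contDiffOn_infty_iff_deriv_of_isOpen L.isOpen_I]
    exact ⟨fun t ht => (hH t ht).differentiableAt.differentiableWithinAt,
      L.smooth_h.congr fun t ht => (hH t ht).deriv⟩
  rw [contDiffOn_infty_iff_deriv_of_isOpen L.isOpen_I]
  exact ⟨fun t ht => (hθ t ht).differentiableAt.differentiableWithinAt,
    sH.neg.exp.congr fun t ht => (hθ t ht).deriv⟩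

theorem BurgersEq.IsDampingIntegral.deriv_ne_zero {L : BurgersEq} {θ : ℝ → ℝ}
    (h : L.IsDampingIntegral θ) {t : ℝ} (ht : t ∈ L.I) : deriv θ t ≠ 0 := by
  obtain ⟨H, hH, hθ⟩ := h
  rw [(hθ t ht).deriv]
  exact Real.exp_ne_zero _

theorem BurgersEq.IsDampingIntegral.deriv_deriv {L : BurgersEq} {θ : ℝ → ℝ}
    (h : L.IsDampingIntegral θ) {t : ℝ} (ht : t ∈ L.I) :
    deriv (deriv θ) t = -(L.h t * deriv θ t) := by
  obtain ⟨H, hH, hθ⟩ := h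
  have := deriv_and_deriv_deriv L.isOpen_I hθ (fun t ht => ((hH t ht).neg).exp) ht
  rw [this.2, this.1]
  simp; ring

/-- On an interval, the solutions of `y'' = -h y'` are the functions `γ θ + δ`. -/
theorem BurgersEq.IsDampingIntegral.exists_eq_of_ode {L : BurgersEq} {θ : ℝ → ℝ}
    (h : L.IsDampingIntegral θ) {J : Set ℝ} (hJ : IsOpen J) (hc : J.OrdConnected)
    (hs : J ⊆ L.I) {y : ℝ → ℝ} (sy : ContDiffOn ℝ ∞ y J)
    (hy : ∀ t ∈ J, deriv (deriv y) t = -(L.h t * deriv y t)) :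
    ∃ γ δ : ℝ, ∀ t ∈ J, y t = γ * θ t + δ := by
  have sθ := h.contDiffOn.mono hs
  have θ1 := fun t (ht : t ∈ J) => sθ.hasDerivAt_infty hJ ht
  have θ2 := fun t (ht : t ∈ J) => (sθ.deriv_infty hJ).hasDerivAt_infty hJ ht
  have y1 := fun t (ht : t ∈ J) => sy.hasDerivAt_infty hJ ht
  have y2 := fun t (ht : t ∈ J) => (sy.deriv_infty hJ).hasDerivAt_infty hJ ht
  have θ0 := fun t (ht : t ∈ J) => h.deriv_ne_zero (hs ht)
  obtain ⟨γ, hγ⟩ := hJ.exists_is_const_of_deriv_eq_zero hc.isPreconnected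
    (f := fun t => deriv y t / deriv θ t)
    (fun t ht => ((y2 t ht).div (θ2 t ht) (θ0 t ht)).differentiableAt.differentiableWithinAt)
    (fun t ht => by
      refine ((y2 t ht).div (θ2 t ht) (θ0 t ht)).deriv.trans ?_
      rw [hy t ht, h.deriv_deriv (hs ht)]
      simp only [Pi.zero_apply]
      ring)
  obtain ⟨δ, hδ⟩ := hJ.exists_is_const_of_deriv_eq_zero hc.isPreconnected
    (f := fun t => y t - γ * θ t)
    (fun t ht => ((y1 t ht).sub ((θ1 t ht).const_mul γ)).differentiableAt.differentiableWithinAt)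
    (fun t ht => by
      refine ((y1 t ht).sub ((θ1 t ht).const_mul γ)).deriv.trans ?_
      rw [← hγ t ht, div_mul_cancel₀ _ (θ0 t ht), sub_self]; rfl)
  exact ⟨γ, δ, fun t ht => by rw [← hδ t ht]; ring⟩

section Parameters

variable {L L' : BurgersEq} {θ : ℝ → ℝ} {J : Set ℝ} {c : TransfParams}

/-- Smoothness of `X¹`, its derivatives, and the equation it satisfies as the coefficient `A` of a
normal form. -/
theorem TransfParams.X1_data (h : L.IsDampingIntegral θ) (hJ : IsOpen J) (hs : J ⊆ L.I)
    (hc : c.Valid θ J) : ContDiffOn ℝ ∞ (c.X1 θ) J ∧ ∀ t ∈ J, c.X1 θ t ≠ 0 ∧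
      deriv (c.X1 θ) t = -(c.γ * deriv θ t * c.X1 θ t ^ 2) ∧
      deriv (deriv (c.X1 θ)) t = (2 * (deriv (c.X1 θ) t / c.X1 θ t) - L.h t) * deriv (c.X1 θ) t := by
  obtain ⟨-, -, -, hn⟩ := hc
  have sθ := h.contDiffOn.mono hs
  have θ1 := fun t (ht : t ∈ J) => sθ.hasDerivAt_infty hJ ht
  have θ2 := fun t (ht : t ∈ J) => (sθ.deriv_infty hJ).hasDerivAt_infty hJ ht
  have sX : ContDiffOn ℝ ∞ (c.X1 θ) J :=
    ((contDiffOn_const.mul sθ).add contDiffOn_const).inv hn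
  refine ⟨sX, fun t ht => ?_⟩
  have y1 : ∀ t ∈ J, HasDerivAt (c.X1 θ)
      (-(c.γ * deriv θ t) / (c.γ * θ t + c.δ) ^ 2) t := fun t ht =>
    (((θ1 t ht).const_mul c.γ).add_const c.δ).inv (hn t ht)
  have d := deriv_and_deriv_deriv hJ y1 (fun t ht => (((θ2 t ht).const_mul c.γ).neg).div
    ((((θ1 t ht).const_mul c.γ).add_const c.δ).pow 2) (pow_ne_zero 2 (hn t ht))) ht
  have n := hn t ht
  have hX : c.X1 θ t = (c.γ * θ t + c.δ)⁻¹ := rfl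
  refine ⟨by rw [hX]; exact inv_ne_zero n, ?_, ?_⟩
  · rw [d.1, hX]; field_simp
  · rw [d.2, d.1, hX, h.deriv_deriv (hs ht)]
    simp only [Pi.neg_apply]
    field_simp
    ring

/-- The derivatives of `X¹ (μ₁ θ + μ₀)`, the coefficient `B` of the normal form. -/
theorem TransfParams.shift_data (h : L.IsDampingIntegral θ) (hJ : IsOpen J) (hs : J ⊆ L.I)
    (hc : c.Valid θ J) {t : ℝ} (ht : t ∈ J) :
    deriv (fun t => c.X1 θ t * (c.μ₁ * θ t + c.μ₀)) t
        = deriv (c.X1 θ) t * (c.μ₁ * θ t + c.μ₀) + c.X1 θ t * (c.μ₁ * deriv θ t) ∧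
      deriv (deriv fun t => c.X1 θ t * (c.μ₁ * θ t + c.μ₀)) t
        = (deriv (deriv (c.X1 θ)) t * (c.μ₁ * θ t + c.μ₀) + deriv (c.X1 θ) t * (c.μ₁ * deriv θ t))
          + (deriv (c.X1 θ) t * (c.μ₁ * deriv θ t) + c.X1 θ t * (c.μ₁ * deriv (deriv θ) t)) := by
  obtain ⟨sX, -⟩ := TransfParams.X1_data h hJ hs hc
  have sθ := h.contDiffOn.mono hs
  have θ1 := fun t (ht : t ∈ J) => sθ.hasDerivAt_infty hJ ht
  have θ2 := fun t (ht : t ∈ J) => (sθ.deriv_infty hJ).hasDerivAt_infty hJ ht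
  have X1 := fun t (ht : t ∈ J) => sX.hasDerivAt_infty hJ ht
  have X2 := fun t (ht : t ∈ J) => (sX.deriv_infty hJ).hasDerivAt_infty hJ ht
  have zd := fun t ht => ((θ1 t ht).const_mul c.μ₁).add_const c.μ₀
  exact deriv_and_deriv_deriv hJ (fun t ht => (X1 t ht).mul (zd t ht))
    (fun t ht => ((X2 t ht).mul (zd t ht)).add ((X1 t ht).mul ((θ2 t ht).const_mul c.μ₁))) ht

theorem TransfParams.map_eq_affineMap (h : L.IsDampingIntegral θ) (hJ : IsOpen J) (hs : J ⊆ L.I)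
    (hc : c.Valid θ J) {p : ℝ × ℝ × ℝ} (hp : p.1 ∈ J) :
    c.map θ p = affineMap c.T (c.X1 θ) (fun t => c.X1 θ t * (c.μ₁ * θ t + c.μ₀)) p := by
  have x0 := ((TransfParams.X1_data h hJ hs hc).2 _ hp).1
  have t0 := hc.2.1 _ hp
  simp only [TransfParams.map, affineMap, (TransfParams.shift_data h hJ hs hc hp).1,
    Prod.mk.injEq, true_and]
  constructor
  · ring
  · field_simp
    ring

theorem TransfParams.isNormalForm (h : L.IsDampingIntegral θ) (hJ : IsOpen J) (hs : J ⊆ L.I)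
    (hc : c.Valid θ J) (he : c.ElementRules θ L L' J) :
    IsNormalForm L L' c.T (c.X1 θ) (fun t => c.X1 θ t * (c.μ₁ * θ t + c.μ₀)) J := by
  obtain ⟨sX, hX⟩ := TransfParams.X1_data h hJ hs hc
  have sθ := h.contDiffOn.mono hs
  refine ⟨hc.1, sX, sX.mul ((contDiffOn_const.mul sθ).add contDiffOn_const), hc.2.1,
    fun t ht => (hX t ht).1, fun t ht => (hX t ht).2.2, ?_, ?_, fun t ht => (he t ht).2⟩
  · intro t ht
    obtain ⟨x0, x1, x2⟩ := hX t ht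
    obtain ⟨z1, z2⟩ := TransfParams.shift_data h hJ hs hc ht
    rw [z1, z2, x2, h.deriv_deriv (hs ht)]
    field_simp
    ring
  · intro t ht
    rw [(he t ht).1]; ring

/-- A normal form over an interval comes from parameters. The functions `1 / A` and `B / A` both
satisfy the equation `y'' = -h y'`, which gives the constants. -/
theorem IsNormalForm.exists_params (h : L.IsDampingIntegral θ) (hJ : IsOpen J)
    (hc : J.OrdConnected) (hne : J.Nonempty) (hs : J ⊆ L.I) {T A B : ℝ → ℝ}
    (H : IsNormalForm L L' T A B J) : ∃ c : TransfParams, c.Valid θ J ∧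
      c.ElementRules θ L L' J ∧ ∀ p : ℝ × ℝ × ℝ, p.1 ∈ J → c.map θ p = affineMap T A B p := by
  have a0 := H.A_ne_zero
  have a1 := fun t ht => H.smooth_A.hasDerivAt_infty hJ (t := t) ht
  have b1 := fun t ht => H.smooth_B.hasDerivAt_infty hJ (t := t) ht
  have a2 := fun t ht => (H.smooth_A.deriv_infty hJ).hasDerivAt_infty hJ (t := t) ht
  have b2 := fun t ht => (H.smooth_B.deriv_infty hJ).hasDerivAt_infty hJ (t := t) ht
  have dY := fun t ht => deriv_and_deriv_deriv hJ (t := t) (f := fun t => (A t)⁻¹)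
    (fun t ht => (a1 t ht).inv (a0 t ht))
    (fun t ht => (a2 t ht).neg.div ((a1 t ht).pow 2) (pow_ne_zero 2 (a0 t ht))) ht
  have dZ := fun t ht => deriv_and_deriv_deriv hJ (t := t) (f := fun t => B t / A t)
    (fun t ht => (b1 t ht).div (a1 t ht) (a0 t ht))
    (fun t ht => (((b2 t ht).mul (a1 t ht)).sub ((b1 t ht).mul (a2 t ht))).div
      ((a1 t ht).pow 2) (pow_ne_zero 2 (a0 t ht))) ht
  simp only [Pi.mul_apply, Pi.sub_apply, Pi.neg_apply] at dY dZ
  obtain ⟨γ, δ, hY⟩ := h.exists_eq_of_ode (y := fun t => (A t)⁻¹) hJ hc hs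
    (H.smooth_A.inv a0) (by
    intro t ht
    have n := a0 t ht
    rw [(dY t ht).1, (dY t ht).2, H.ode_A t ht]
    field_simp
    ring)
  obtain ⟨μ₁, μ₀, hZ⟩ := h.exists_eq_of_ode (y := fun t => B t / A t) hJ hc hs
    (H.smooth_B.div H.smooth_A a0) (by
    intro t ht
    have n := a0 t ht
    rw [(dZ t ht).1, (dZ t ht).2, H.ode_A t ht, H.ode_B t ht]
    field_simp
    ring)
  let c : TransfParams := ⟨T, γ, δ, μ₀, μ₁⟩
  have hX : Set.EqOn (c.X1 θ) A J := fun t ht => by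
    change (γ * θ t + δ)⁻¹ = A t
    rw [← hY t ht, inv_inv]
  have hB : Set.EqOn (fun t => c.X1 θ t * (c.μ₁ * θ t + c.μ₀)) B J := fun t ht => by
    change c.X1 θ t * (μ₁ * θ t + μ₀) = B t
    rw [hX ht, ← hZ t ht, mul_div_cancel₀ _ (a0 t ht)]
  have hval : c.Valid θ J := by
    have hn : ∀ t ∈ J, γ * θ t + δ ≠ 0 := fun t ht => by
      rw [← hY t ht]; exact inv_ne_zero (a0 t ht)
    refine ⟨H.smooth_T, H.deriv_T_ne_zero, ?_, hn⟩
    obtain ⟨t, ht⟩ := hne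
    intro he
    obtain ⟨e1, e2⟩ := Prod.mk.inj he
    refine hn t ht ?_
    change c.γ * θ t + c.δ = 0
    rw [e1, e2]; ring
  refine ⟨c, hval, fun t ht => ?_, fun p hp => ?_⟩
  · rw [hX ht, deriv_congr_of_eqOn hJ hX ht]
    refine ⟨?_, H.g_rule t ht⟩
    rw [H.h_rule t ht]
    change _ = 1 / deriv T t * (L.h t + deriv (deriv T) t / deriv T t - _)
    ring
  · rw [TransfParams.map_eq_affineMap h hJ hs hval hp]
    exact affineMap_congr hJ hX hB hp

end Parameters

/-! ### The generalized extended equivalence group -/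

/-- The transformation `σ` of the joint space permutes the equations and acts on the variables by
a transformation of the normal form, for each equation. -/
def IsFiberwiseNormal (σ : Equiv.Perm JointSpace) : Prop :=
  ∃ S : Equiv.Perm BurgersEq, ∀ L : BurgersEq, ∃ T A B : ℝ → ℝ,
    IsNormalForm L (S L) T A B L.I ∧
    ∀ z : JointSpace, z.1.1 = L → (σ z).1 = (S L, affineMap T A B z.1.2)

theorem mapsTo_of_fiber {σ : Equiv.Perm JointSpace} {L L' : BurgersEq} {T A B : ℝ → ℝ}
    (h : ∀ z : JointSpace, z.1.1 = L → (σ z).1 = (L', affineMap T A B z.1.2)) :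
    Set.MapsTo T L.I L'.I := by
  intro t ht
  have h1 := h ⟨(L, (t, 0, 0)), ht⟩ rfl
  have h2 := (σ ⟨(L, (t, 0, 0)), ht⟩).2
  rw [h1] at h2
  exact h2

theorem IsFiberwiseNormal.one : IsFiberwiseNormal 1 :=
  ⟨1, fun L => ⟨id, fun _ => 1, fun _ => 0, IsNormalForm.refl L L.I, fun z hz => by
    rw [affineMap_refl, ← hz]; rfl⟩⟩

theorem IsFiberwiseNormal.mul {σ τ : Equiv.Perm JointSpace} (hσ : IsFiberwiseNormal σ)
    (hτ : IsFiberwiseNormal τ) : IsFiberwiseNormal (σ * τ) := by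
  obtain ⟨S, hS⟩ := hσ
  obtain ⟨R, hR⟩ := hτ
  refine ⟨S * R, fun L => ?_⟩
  obtain ⟨T, A, B, H, h⟩ := hR L
  obtain ⟨T', A', B', H', h'⟩ := hS (R L)
  obtain ⟨N, hN⟩ := IsNormalForm.comp L.isOpen_I (R L).isOpen_I H' H (mapsTo_of_fiber h)
  refine ⟨_, _, _, N, fun z hz => ?_⟩
  have hz2 : z.1.2.1 ∈ L.I := by rw [← hz]; exact z.2
  rw [Equiv.Perm.mul_apply, h' (τ z) (by rw [h z hz]), h z hz, hN _ hz2]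
  rfl

theorem IsFiberwiseNormal.inv {σ : Equiv.Perm JointSpace} (hσ : IsFiberwiseNormal σ) :
    IsFiberwiseNormal σ⁻¹ := by
  obtain ⟨S, hS⟩ := hσ
  refine ⟨S⁻¹, fun L => ?_⟩
  obtain ⟨M, rfl⟩ := S.surjective L
  rw [show S⁻¹ (S M) = M from S.symm_apply_apply M]
  obtain ⟨T, A, B, H, h⟩ := hS M
  -- `σ` is onto, so the whole interval of the image equation is reached
  have himg : T '' M.I = (S M).I := by
    refine (mapsTo_of_fiber h).image_subset.antisymm fun t ht => ?_
    obtain ⟨w, hw⟩ := σ.surjective ⟨(S M, (t, 0, 0)), ht⟩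
    obtain ⟨T₁, A₁, B₁, -, h₁⟩ := hS w.1.1
    have e := h₁ w rfl
    rw [hw] at e
    have hM : w.1.1 = M := S.injective (congrArg Prod.fst e).symm
    have e' := h w hM
    rw [hw] at e'
    exact ⟨w.1.2.1, by rw [← hM]; exact w.2, (congrArg (fun y => y.2.1) e').symm⟩
  obtain ⟨T', A', B', H', hT, -, hr⟩ := H.exists_inverse M.isOpen_I M.ordConnected_I
  rw [himg] at H' hr
  refine ⟨T', A', B', H', fun z hz => ?_⟩
  have hz2 : z.1.2.1 ∈ (S M).I := by rw [← hz]; exact z.2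
  have hmem : T' z.1.2.1 ∈ M.I := by
    rw [← himg] at hz2
    obtain ⟨t, ht, hte⟩ := hz2
    rw [← hte, hT t ht]; exact ht
  have key : σ ⟨(M, affineMap T' A' B' z.1.2), hmem⟩ = z := by
    refine Subtype.ext ?_
    rw [h _ rfl, hr _ hz2, ← hz]
  rw [Equiv.Perm.inv_eq_iff_eq.2 key.symm]

/-- The group of the transformations that have the normal form for each equation. -/
def normalFormGroup : Subgroup (Equiv.Perm JointSpace) where
  carrier := {σ | IsFiberwiseNormal σ}
  one_mem' := IsFiberwiseNormal.one
  mul_mem' := IsFiberwiseNormal.mul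
  inv_mem' := IsFiberwiseNormal.inv

theorem IsFiberwiseNormal.isGenExtEquivalence {σ : Equiv.Perm JointSpace}
    (h : IsFiberwiseNormal σ) : IsGenExtEquivalence σ := by
  obtain ⟨S, hS⟩ := h
  refine ⟨S, fun L => ?_⟩
  obtain ⟨T, A, B, H, h⟩ := hS L
  refine ⟨affineMap T A B, ?_, fun p hp => h _ rfl⟩
  exact IsNormalForm.isAdmissible L.isOpen_strip subset_rfl
    (fun p hp => mapsTo_of_fiber h hp) (by rw [L.image_fst_strip]; exact H) fun _ _ => rfl

theorem IsGenExtEquivalence.isFiberwiseNormal {σ : Equiv.Perm JointSpace}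
    (h : IsGenExtEquivalence σ) : IsFiberwiseNormal σ := by
  obtain ⟨S, hS⟩ := h
  refine ⟨S, fun L => ?_⟩
  obtain ⟨F, hF, h⟩ := hS L
  obtain ⟨T, A, B, H, hFT⟩ := hF.exists_isNormalForm L.isOpen_strip L.convex_strip
  rw [L.image_fst_strip] at H
  refine ⟨T, A, B, H, ?_⟩
  rintro ⟨⟨_, p⟩, hp⟩ rfl
  rw [h p hp, hFT hp]

open Classical in
/-- The transposition of two fibers of the joint space by mutually inverse maps `F` and `F'`. -/
noncomputable def swapFibers (L L' : BurgersEq) (F F' : ℝ × ℝ × ℝ → ℝ × ℝ × ℝ)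
    (z : BurgersEq × (ℝ × ℝ × ℝ)) : BurgersEq × (ℝ × ℝ × ℝ) :=
  if z.1 = L then (L', F z.2) else if z.1 = L' then (L, F' z.2) else z

section SwapFibers

variable {L L' : BurgersEq} {F F' : ℝ × ℝ × ℝ → ℝ × ℝ × ℝ}

theorem swapFibers_mem (h : Set.MapsTo F L.strip L'.strip) (h' : Set.MapsTo F' L'.strip L.strip)
    {z : BurgersEq × (ℝ × ℝ × ℝ)} (hz : z.2 ∈ z.1.strip) :
    (swapFibers L L' F F' z).2 ∈ (swapFibers L L' F F' z).1.strip := by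
  unfold swapFibers
  split_ifs with h1 h2
  · exact h (h1 ▸ hz)
  · exact h' (h2 ▸ hz)
  · exact hz

theorem swapFibers_swapFibers (hl : ∀ p ∈ L.strip, F' (F p) = p)
    (hr : ∀ p ∈ L'.strip, F (F' p) = p) {z : BurgersEq × (ℝ × ℝ × ℝ)} (hz : z.2 ∈ z.1.strip) :
    swapFibers L' L F' F (swapFibers L L' F F' z) = z := by
  obtain ⟨M, p⟩ := z
  by_cases h1 : M = L
  · subst h1
    simp only [swapFibers, if_true]
    rw [hl p hz]
  · by_cases h2 : M = L'
    · subst h2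
      have h3 : L ≠ M := fun h => h1 h.symm
      simp [swapFibers, h1, h3, hr p hz]
    · simp [swapFibers, h1, h2]

end SwapFibers

/-- A transformation of the normal form, from an equation onto its image, extends to an element of
the group: exchange the two equations by this transformation and its inverse, and fix all other
equations. -/
theorem IsNormalForm.exists_mem_group {L L' : BurgersEq} {T A B : ℝ → ℝ}
    (H : IsNormalForm L L' T A B L.I) (hI : L'.I = T '' L.I) :
    ∃ σ ∈ normalFormGroup, ∀ z : JointSpace, z.1.1 = L →
      (σ z).1 = (L', affineMap T A B z.1.2) := by
  classical
  obtain ⟨T', A', B', H', hT, hl, hr⟩ := H.exists_inverse L.isOpen_I L.ordConnected_I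
  rw [← hI] at H' hr
  have m : Set.MapsTo (affineMap T A B) L.strip L'.strip := fun p hp => by
    change T p.1 ∈ L'.I
    rw [hI]; exact ⟨p.1, hp, rfl⟩
  have m' : Set.MapsTo (affineMap T' A' B') L'.strip L.strip := fun p hp => by
    change p.1 ∈ L'.I at hp
    change T' p.1 ∈ L.I
    rw [hI] at hp
    obtain ⟨t, ht, hte⟩ := hp
    rw [← hte, hT t ht]; exact ht
  let σ : Equiv.Perm JointSpace :=
    { toFun := fun z => ⟨swapFibers L L' (affineMap T A B) (affineMap T' A' B') z.1,
        swapFibers_mem m m' z.2⟩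
      invFun := fun z => ⟨swapFibers L' L (affineMap T' A' B') (affineMap T A B) z.1,
        swapFibers_mem m' m z.2⟩
      left_inv := fun z => Subtype.ext (swapFibers_swapFibers hl hr z.2)
      right_inv := fun z => Subtype.ext (swapFibers_swapFibers hr hl z.2) }
  have hσ : ∀ z : JointSpace, z.1.1 = L → (σ z).1 = (L', affineMap T A B z.1.2) :=
    fun z hz => if_pos hz
  refine ⟨σ, ⟨Equiv.swap L L', fun M => ?_⟩, hσ⟩
  by_cases h1 : M = L
  · subst h1
    rw [Equiv.swap_apply_left]
    exact ⟨T, A, B, H, hσ⟩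
  · by_cases h2 : M = L'
    · subst h2
      rw [Equiv.swap_apply_right]
      refine ⟨T', A', B', H', fun z hz => ?_⟩
      have h3 : z.1.1 ≠ L := hz ▸ h1
      exact (if_neg h3).trans (if_pos hz)
    · rw [Equiv.swap_apply_of_ne_of_ne h1 h2]
      refine ⟨id, fun _ => 1, fun _ => 0, IsNormalForm.refl M M.I, fun z hz => ?_⟩
      rw [affineMap_refl]
      have h3 : z.1.1 ≠ L := hz ▸ h1
      have h4 : z.1.1 ≠ L' := hz ▸ h2
      refine (if_neg h3).trans ((if_neg h4).trans ?_)
      rw [← hz]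

theorem isNormalizedWith_normalFormGroup : IsNormalizedWith normalFormGroup := by
  intro L L' F Ω hΩ hc hne hF
  obtain ⟨T, A, B, H, hFT⟩ := hF.exists_isNormalForm hΩ hc
  have hJ := isOpen_image_fst hΩ
  have hJc : (Prod.fst '' Ω).OrdConnected :=
    convex_iff_ordConnected.1 (hc.linear_image (LinearMap.fst ℝ ℝ (ℝ × ℝ)))
  have hJL : Prod.fst '' Ω ⊆ L.I := by
    rintro _ ⟨p, hp, rfl⟩; exact hF.1 hp
  have hJL' : T '' (Prod.fst '' Ω) ⊆ L'.I := by
    rintro _ ⟨_, ⟨p, hp, rfl⟩, rfl⟩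
    have := hF.2.1 hp
    rw [hFT hp] at this
    exact this
  obtain ⟨L₁, h₁, e₁⟩ := L.exists_restriction hJ hJc (hne.image _) hJL
  obtain ⟨L₁', h₁', e₁'⟩ := L'.exists_restriction
    (isOpen_image_of_deriv_ne_zero hJ H.smooth_T H.deriv_T_ne_zero)
    (ordConnected_image hJc H.smooth_T.continuousOn) ((hne.image _).image T) hJL'
  have H₁ : IsNormalForm L₁ L₁' T A B L₁.I := by
    rw [e₁]
    exact H.restriction h₁ h₁' e₁.ge (fun t ht => by rw [e₁']; exact ⟨t, ht, rfl⟩)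
  obtain ⟨σ, hσ, h⟩ := H₁.exists_mem_group (by rw [e₁, e₁'])
  exact ⟨σ, hσ, L₁, L₁', h₁, e₁, h₁', fun z hz hzΩ => by rw [h z hz, hFT hzΩ]⟩

theorem theorem2
    -- for every equation of the class, a fixed antiderivative `∫ e^{-∫ h dt} dt`
    (θ : BurgersEq → ℝ → ℝ) (hθ : ∀ L : BurgersEq, L.IsDampingIntegral (θ L)) :
    ∃ G : Subgroup (Equiv.Perm JointSpace),
      -- `G` is the generalized extended equivalence group of the class
      (∀ σ : Equiv.Perm JointSpace, σ ∈ G ↔ IsGenExtEquivalence σ) ∧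
      -- `G` consists of the transformations of the stated form
      (∀ σ : Equiv.Perm JointSpace, σ ∈ G ↔
        ∃ S : Equiv.Perm BurgersEq, ∀ L : BurgersEq, ∃ c : TransfParams,
          c.Valid (θ L) L.I ∧ c.ElementRules (θ L) L (S L) L.I ∧
          ∀ p (hp : p ∈ L.strip), (σ ⟨(L, p), hp⟩).1 = (S L, c.map (θ L) p)) ∧
      -- all values of the parameters occur, for every equation
      (∀ (c : TransfParams) (L : BurgersEq), c.Valid (θ L) L.I →
        ∃ σ ∈ G, ∃ L' : BurgersEq, L'.I = c.T '' L.I ∧ c.ElementRules (θ L) L L' L.I ∧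
          ∀ p (hp : p ∈ L.strip), (σ ⟨(L, p), hp⟩).1 = (L', c.map (θ L) p)) ∧
      -- the class is normalized in the generalized extended sense
      IsNormalizedWith G ∧
      -- explicitly: the admissible transformations are exactly those of the stated form
      (∀ (L L' : BurgersEq) (F : ℝ × ℝ × ℝ → ℝ × ℝ × ℝ) (Ω : Set (ℝ × ℝ × ℝ)),
        IsOpen Ω → Convex ℝ Ω → Ω.Nonempty → Ω ⊆ L.strip → Set.MapsTo F Ω L'.strip →
        (IsAdmissible L L' F Ω ↔
          ∃ c : TransfParams, c.Valid (θ L) (Prod.fst '' Ω) ∧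
            c.ElementRules (θ L) L L' (Prod.fst '' Ω) ∧ Set.EqOn F (c.map (θ L)) Ω)) := by
  refine ⟨normalFormGroup, fun σ => ⟨IsFiberwiseNormal.isGenExtEquivalence,
    IsGenExtEquivalence.isFiberwiseNormal⟩, fun σ => ⟨?_, ?_⟩, ?_,
    isNormalizedWith_normalFormGroup, ?_⟩
  · rintro ⟨S, hS⟩
    refine ⟨S, fun L => ?_⟩
    obtain ⟨T, A, B, H, h⟩ := hS L
    obtain ⟨c, hc, he, hm⟩ := H.exists_params (hθ L) L.isOpen_I L.ordConnected_I L.nonempty_I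
      subset_rfl
    exact ⟨c, hc, he, fun p hp => by rw [h _ rfl, hm p hp]⟩
  · rintro ⟨S, hS⟩
    refine ⟨S, fun L => ?_⟩
    obtain ⟨c, hc, he, h⟩ := hS L
    refine ⟨_, _, _, TransfParams.isNormalForm (hθ L) L.isOpen_I subset_rfl hc he, ?_⟩
    rintro ⟨⟨_, p⟩, hp⟩ rfl
    rw [h p hp, TransfParams.map_eq_affineMap (hθ _) (BurgersEq.isOpen_I _) subset_rfl hc hp]
  · intro c L hc
    obtain ⟨sX, hX⟩ := TransfParams.X1_data (hθ L) L.isOpen_I subset_rfl hc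
    obtain ⟨L', hI, hL'⟩ := exists_image_equation L hc.1 sX hc.2.1 fun t ht => (hX t ht).1
    have he : c.ElementRules (θ L) L L' L.I := fun t ht =>
      ⟨by rw [(hL' t ht).1]; ring, (hL' t ht).2⟩
    obtain ⟨σ, hσ, h⟩ :=
      (TransfParams.isNormalForm (hθ L) L.isOpen_I subset_rfl hc he).exists_mem_group hI
    exact ⟨σ, hσ, L', hI, he, fun p hp => by
      rw [h _ rfl, TransfParams.map_eq_affineMap (hθ L) L.isOpen_I subset_rfl hc hp]⟩
  · intro L L' F Ω hΩ hc hne hs ht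
    have hJ := isOpen_image_fst hΩ
    have hJc : (Prod.fst '' Ω).OrdConnected :=
      convex_iff_ordConnected.1 (hc.linear_image (LinearMap.fst ℝ ℝ (ℝ × ℝ)))
    have hJL : Prod.fst '' Ω ⊆ L.I := by
      rintro _ ⟨p, hp, rfl⟩; exact hs hp
    constructor
    · intro hF
      obtain ⟨T, A, B, H, hFT⟩ := hF.exists_isNormalForm hΩ hc
      obtain ⟨c, hc, he, hm⟩ := H.exists_params (hθ L) hJ hJc (hne.image _) hJL
      exact ⟨c, hc, he, fun p hp => by rw [hFT hp, hm p ⟨p, hp, rfl⟩]⟩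
    · rintro ⟨c, hc, he, hm⟩
      exact (TransfParams.isNormalForm (hθ L) hJ hJL hc he).isAdmissible hΩ hs ht fun p hp => by
        rw [hm hp, TransfParams.map_eq_affineMap (hθ L) hJ hJL hc ⟨p, hp, rfl⟩]
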